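/- **Setting.** A *polytope scheduling problem* is given by a set $\Omega$ of job kinds, a weight $w_k\ge 0$ for each kind $k$, and a set $\mathcal P$ of nonnegative vectors $z=(z_j)_j$, indexed by the jobs $j\in\Omega\times\mathbb N$ (the jobs $(k,0),(k,1),\dots$ are the copies of the kind $k$; $w_j$ is the weight of the kind of $j$). $\mathcal P$ is the set of vectors of processing rates that are feasible at a moment. It is nonempty, convex, compact (in the product topology), downward-closed and invariant under permutations of jobs that preserve kinds, and for each $j$ it contains some $z$ with $z_j>0$. An instance is a finite set $J$ of jobs with release times $r_j\ge 0$ and sizes $p_j>0$. A schedule is a measurable map $t\mapsto z(t)\in\mathcal P$. Run at speed $s$ it leaves job $j$ with remaining size $p_j(t)=\max\{p_j-s\int_{r_j}^t z_j,\,0\}$ at times $t\ge r_j$, and we put $p_j(t)=0$ for $t<r_j$, when the job is not yet present. Job $j$ completes at the first time $C_j\ge r_j$ (possibly $\infty$) by which it has received $p_j$ units of processing since its release, and the total weighted flow time is $\sum_{j\in J} w_j(C_j-r_j)$. Let $\mathrm{OPT}$ be the infimum of the total weighted flow time over all schedules run at speed $1$. For a vector $x\ge 0$ of remaining sizes of finitely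 many jobs, the *residual optimum* $f(x)$ is the minimum (infimum) of $\sum_j w_j\tilde C_j$ over the schedules at speed $1$ in which all these jobs are available at time $0$ and $j$ has size $x_j$; here $\tilde C_j$ is the completion time of $j$, so that $\tilde C_j=0$ if $x_j=0$. The residual optimum is *supermodular* if for every $x\ge0$ the function $S\mapsto f(x\odot \mathbf 1_S)$ on finite sets $S$ of jobs is supermodular: $$f(x\odot\mathbf 1_U)+f(x\odot\mathbf 1_V)\le f(x\odot\mathbf 1_{U\cup V})+f(x\odot\mathbf 1_{U\cap V}).$$ A schedule $z$ run at speed $s$ is a *gradient descent schedule* if at almost every time $t\ge 0$ it decreases the residual optimum of the jobs present as fast as possible: for every $\eta>0$ and all sufficiently small $h>0$, $$f(p(t+h))\le f\big(\max\{p(t)-s\,h\,y,\,0\}\big)+\eta h\qquad\text{for all } y\in\mathcal P .$$ **Theorem.** There is an absolute constant $C>0$ such that the following holds for every polytope scheduling problem whose residual optimum is supermodular and every $\varepsilon>0$. There is an online algorithm (its decisions before any time $T$ depend only on the jobs released before $T$) that produces a gradient descent schedule of speed $1+\varepsilon$ on every instance. On every instance, every gradient descent schedule of speed $1+\varepsilon$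 has total weighted flow time at most $C\max\{1,1/\varepsilon\}\cdot\mathrm{OPT}$. That is, gradient descent is $(1+\varepsilon)$-speed $O(1/\varepsilon)$-competitive for total weighted flow time. -/

import Mathlib

open MeasureTheory Filter Topology
open scoped ENNReal NNReal

universe u

noncomputable section

/-- A job is a pair of a job kind and a label. The jobs `(k, 0), (k, 1), ...` are the
copies of one and the same kind `k` of job. -/
abbrev Job (Ω : Type u) : Type u := Ω × ℕ

/-- A polytope scheduling problem (PSP) over a set `Ω` of job kinds. A kind fixes the weight of a
job and its role in the processing constraints; sizes and release times belong to the instances.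
`rates` is the set of the vectors `z` of processing rates (job `j` is processed at rate `z j`) that
are feasible at a moment at unit speed. It is a compact (in the product topology), convex,
downward-closed set of nonnegative vectors, every job can be processed at all, and copies of the
same kind of job are interchangeable. -/
structure SchedulingProblem (Ω : Type u) where
  weight : Ω → ℝ≥0
  rates : Set (Job Ω → ℝ)
  rates_nonneg : ∀ z ∈ rates, ∀ j, 0 ≤ z j
  zero_mem : (0 : Job Ω → ℝ) ∈ rates
  isCompact_rates : IsCompact rates
  convex_rates : Convex ℝ rates
  downward_closed : ∀ z ∈ rates, ∀ y : Job Ω → ℝ, (∀ j, 0 ≤ y j ∧ y j ≤ z j) → y ∈ rates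
  exists_pos : ∀ j, ∃ z ∈ rates, 0 < z j
  copies_symm : ∀ σ : Equiv.Perm (Job Ω), (∀ j, (σ j).1 = j.1) →
    ∀ z ∈ rates, (fun j => z (σ j)) ∈ rates

/-- The time that passes from time `r` on until a job that is processed at rate `rate u` at time
`u` has received `x` units of processing (`⊤` if this never happens). -/
def completionDelay (rate : ℝ → ℝ) (r x : ℝ) : ℝ≥0∞ :=
  ⨅ (τ : ℝ) (_ : 0 ≤ τ ∧ x ≤ ∫ v in r..(r + τ), rate v), ENNReal.ofReal τ

namespace SchedulingProblem

variable {Ω : Type u}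

/-- A schedule: a measurable choice of a feasible rate vector for every time. -/
def IsSchedule (Pb : SchedulingProblem Ω) (z : ℝ → Job Ω → ℝ) : Prop :=
  Measurable z ∧ ∀ t, z t ∈ Pb.rates

/-- The residual optimum: the minimum total weighted completion time, at unit speed, of the jobs
of `S` when all of them are available at time `0` and `j` has the remaining size `x j`.
A job with `x j = 0` is complete at time `0`, so that this is `f (x ⊙ 1_S)` for the residual
optimum `f` as a function of the vector of the remaining sizes alone. -/
def residualOptimum (Pb : SchedulingProblem Ω) (S : Finset (Job Ω)) (x : Job Ω → ℝ) : ℝ≥0∞ :=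
  ⨅ (z : ℝ → Job Ω → ℝ) (_ : Pb.IsSchedule z),
    ∑ j ∈ S, (Pb.weight j.1 : ℝ≥0∞) * completionDelay (fun t => z t j) 0 (x j)

open scoped Classical in
/-- (Discrete) supermodularity of the residual optimum: for all remaining sizes `x`, the set
function `S ↦ f (x ⊙ 1_S)` on the finite sets of jobs is supermodular. -/
def HasSupermodularResidualOptimum (Pb : SchedulingProblem Ω) : Prop :=
  ∀ x : Job Ω → ℝ, (∀ j, 0 ≤ x j) → ∀ U V : Finset (Job Ω),
    Pb.residualOptimum U x + Pb.residualOptimum V x ≤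
      Pb.residualOptimum (U ∪ V) x + Pb.residualOptimum (U ∩ V) x

end SchedulingProblem

/-- An instance: finitely many jobs with their release times and sizes (the values of `release`
and `size` outside `jobs` are irrelevant). -/
structure SchedulingInstance (Ω : Type u) where
  jobs : Finset (Job Ω)
  release : Job Ω → ℝ
  size : Job Ω → ℝ
  release_nonneg : ∀ j ∈ jobs, 0 ≤ release j
  size_pos : ∀ j ∈ jobs, 0 < size j

namespace SchedulingProblem

variable {Ω : Type u}

/-- Remaining size of job `j` at time `t` when the rate vectors `z` are run at speed `s`; it is `0`
before the release of `j`, as `j` is not yet present then. Only processing after the release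
counts. -/
def remaining (I : SchedulingInstance Ω) (s : ℝ) (z : ℝ → Job Ω → ℝ) (t : ℝ) (j : Job Ω) : ℝ :=
  if I.release j ≤ t then max (I.size j - ∫ v in (I.release j)..t, s * z v j) 0 else 0

/-- Total weighted flow time (completion time minus release time) of the schedule `z` that is run
at speed `s`. -/
def weightedFlowTime (Pb : SchedulingProblem Ω) (I : SchedulingInstance Ω) (s : ℝ)
    (z : ℝ → Job Ω → ℝ) : ℝ≥0∞ :=
  ∑ j ∈ I.jobs, (Pb.weight j.1 : ℝ≥0∞) *
    completionDelay (fun t => s * z t j) (I.release j) (I.size j)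

/-- The offline optimum at unit speed. -/
def optimalFlowTime (Pb : SchedulingProblem Ω) (I : SchedulingInstance Ω) : ℝ≥0∞ :=
  ⨅ (z : ℝ → Job Ω → ℝ) (_ : Pb.IsSchedule z), Pb.weightedFlowTime I 1 z

/-- `z`, run at speed `s`, is a gradient descent schedule: at almost every time `t` it decreases
the residual optimum of the jobs that are present as fast as is possible. That is, up to an error
`o(h)` as `h ↓ 0`, the residual optimum at time `t + h` is at most what it would be if the jobs
were processed from time `t` on with any other feasible rate vector `y`. -/
def IsGradientDescent (Pb : SchedulingProblem Ω) (I : SchedulingInstance Ω) (s : ℝ)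
    (z : ℝ → Job Ω → ℝ) : Prop :=
  Pb.IsSchedule z ∧
    ∀ᵐ t ∂(volume.restrict (Set.Ici (0 : ℝ))), ∀ η : ℝ, 0 < η → ∀ᶠ h : ℝ in 𝓝[>] 0,
      ∀ y ∈ Pb.rates,
        Pb.residualOptimum I.jobs (remaining I s z (t + h)) ≤
          Pb.residualOptimum I.jobs (fun j => max (remaining I s z t j - s * h * y j) 0) +
            ENNReal.ofReal (η * h)

end SchedulingProblem

/-- Two instances look the same before time `T`: the same jobs are released before `T`, at the same
times and with the same sizes. -/
def SchedulingInstance.AgreeBefore {Ω : Type u} (I I' : SchedulingInstance Ω) (T : ℝ) : Prop :=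
  (∀ j, (j ∈ I.jobs ∧ I.release j < T) ↔ (j ∈ I'.jobs ∧ I'.release j < T)) ∧
    ∀ j ∈ I.jobs, I.release j < T → I.release j = I'.release j ∧ I.size j = I'.size j

/-- A map from instances to schedules is online if its decisions before time `T` depend only on the
jobs released before `T`. -/
def IsOnline {Ω : Type u} (A : SchedulingInstance Ω → ℝ → Job Ω → ℝ) : Prop :=
  ∀ (I I' : SchedulingInstance Ω) (T : ℝ), I.AgreeBefore I' T → ∀ t < T, A I t = A I' t

end

/-! Write f for the residual optimum, s = 1 + ε, and W_A, W_O for the weights of the unfinished jobs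
of gradient descent and of a unit-speed comparison schedule. The proof is a potential argument with
Φ = f(A) − f(A ∪ O)/2. Here A and O are the two vectors of remaining sizes, and in A ∪ O the jobs of
the comparison schedule are distinct copies of those of the algorithm.

Running any feasible rates at speed c lowers f at a rate of at most c times the unfinished weight,
since one may run them and then continue optimally (`resOpt_le_run`). An optimal schedule attains
this bound, because no job completes during a short enough time (`eventually_exists_rate`). Hence
gradient descent lowers f(A) at rate sW_A (`IsGradientDescent.resOpt_add_le`). By convexity the two
schedules together form one schedule of speed s + 1 on A ∪ O, so f(A ∪ O) falls at a rate of at most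
(s + 1)(W_A + W_O) (`resOpt_joint_le`). Therefore Φ′ ≤ −(ε/2)W_A + (1 + ε/2)W_O between releases.

A release adds one job to A and its copy to O, both with full size. Two uses of supermodularity show
that f(A ∪ O) grows by at least twice as much as f(A), so Φ does not increase
(`two_mul_resOpt_insert_le`). Φ starts at 0, and once O is finished it equals f(A)/2 ≥ 0.
Integration gives a cost of at most (1 + 2/ε) times that of the comparison schedule.

A gradient descent schedule is obtained online by following an optimal schedule for the current
remaining sizes and recomputing it at every release. Optimal schedules exist by compactness of the
feasible rates (`exists_optimal_schedule`). -/

noncomputable section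

/-! ### Processing rates and completion delays -/

/-- A nonnegative locally integrable processing rate. -/
structure IsRate (ρ : ℝ → ℝ) : Prop where
  nonneg : ∀ t, 0 ≤ ρ t
  integrable : ∀ a b, IntervalIntegrable ρ volume a b

namespace IsRate

variable {ρ : ℝ → ℝ}

theorem const_mul (h : IsRate ρ) {s : ℝ} (hs : 0 ≤ s) : IsRate (fun t => s * ρ t) :=
  ⟨fun t => mul_nonneg hs (h.nonneg t), fun a b => (h.integrable a b).const_mul s⟩

theorem integral_nonneg (h : IsRate ρ) {a b : ℝ} (hab : a ≤ b) : 0 ≤ ∫ v in a..b, ρ v :=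
  intervalIntegral.integral_nonneg hab fun t _ => h.nonneg t

theorem integral_add (h : IsRate ρ) (a b c : ℝ) :
    (∫ v in a..b, ρ v) + ∫ v in b..c, ρ v = ∫ v in a..c, ρ v :=
  intervalIntegral.integral_add_adjacent_intervals (h.integrable a b) (h.integrable b c)

theorem integral_mono (h : IsRate ρ) (a : ℝ) {b c : ℝ} (hbc : b ≤ c) :
    ∫ v in a..b, ρ v ≤ ∫ v in a..c, ρ v := by
  have := h.integral_add a b c
  have := h.integral_nonneg hbc
  linarith

end IsRate

section Delay

variable {ρ ρ' : ℝ → ℝ} {r x y σ τ : ℝ}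

theorem completionDelay_le (hτ : 0 ≤ τ) (h : x ≤ ∫ v in r..(r + τ), ρ v) :
    completionDelay ρ r x ≤ ENNReal.ofReal τ :=
  iInf₂_le τ ⟨hτ, h⟩

theorem le_completionDelay {c : ℝ≥0∞}
    (h : ∀ τ, 0 ≤ τ → x ≤ ∫ v in r..(r + τ), ρ v → c ≤ ENNReal.ofReal τ) :
    c ≤ completionDelay ρ r x :=
  le_iInf₂ fun τ hτ => h τ hτ.1 hτ.2

theorem completionDelay_of_nonpos (hx : x ≤ 0) : completionDelay ρ r x = 0 := by
  have := completionDelay_le (ρ := ρ) (r := r) (x := x) le_rfl (by simpa using hx)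
  simpa using this

theorem completionDelay_mono (h : x ≤ y) : completionDelay ρ r x ≤ completionDelay ρ r y :=
  le_completionDelay fun _ h0 h1 => completionDelay_le h0 (h.trans h1)

theorem completionDelay_congr (h : ∀ t, r ≤ t → ρ t = ρ' t) :
    completionDelay ρ r x = completionDelay ρ' r x := by
  unfold completionDelay
  congr 1; ext τ
  by_cases h0 : 0 ≤ τ
  · have : ∫ v in r..(r + τ), ρ v = ∫ v in r..(r + τ), ρ' v := by
      apply intervalIntegral.integral_congr
      intro t ht
      rw [Set.uIcc_of_le (by linarith)] at ht
      exact h t ht.1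
    rw [this]
  · simp [h0]

theorem IsRate.le_integral_of_completionDelay_lt (hρ : IsRate ρ)
    (h : completionDelay ρ r x < ENNReal.ofReal τ) : x ≤ ∫ v in r..(r + τ), ρ v := by
  simp only [completionDelay, iInf_lt_iff] at h
  obtain ⟨τ', ⟨_, h1⟩, h2⟩ := h
  have : τ' < τ := by
    by_contra! hc
    exact absurd (ENNReal.ofReal_le_ofReal hc) (not_le.2 h2)
  exact h1.trans (hρ.integral_mono r (by linarith))

theorem IsRate.ofReal_le_completionDelay (hρ : IsRate ρ) (h : ∫ v in r..(r + τ), ρ v < x) :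
    ENNReal.ofReal τ ≤ completionDelay ρ r x := by
  by_contra! hc
  exact absurd (hρ.le_integral_of_completionDelay_lt hc) (not_le.2 h)

theorem IsRate.completionDelay_split (hρ : IsRate ρ) (hσ : 0 ≤ σ) :
    completionDelay ρ r x = min (completionDelay ρ r x) (ENNReal.ofReal σ) +
      completionDelay ρ (r + σ) (max (x - ∫ v in r..(r + σ), ρ v) 0) := by
  rcases le_or_gt x (∫ v in r..(r + σ), ρ v) with h | h
  · rw [min_eq_left (completionDelay_le hσ h),
      completionDelay_of_nonpos (x := max _ _) (by simpa using h), add_zero]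
  · have h1 := hρ.ofReal_le_completionDelay h
    rw [min_eq_right h1, max_eq_left (by linarith)]
    apply le_antisymm
    · rw [← tsub_le_iff_left]
      refine le_completionDelay fun τ h0 h2 => ?_
      rw [tsub_le_iff_left, ← ENNReal.ofReal_add hσ h0]
      refine completionDelay_le (by linarith) ?_
      have := hρ.integral_add r (r + σ) (r + σ + τ)
      rw [← add_assoc]
      linarith
    · refine le_completionDelay fun τ h0 h2 => ?_
      have hστ : σ ≤ τ := by
        by_contra! hc
        have := hρ.integral_mono r (show r + τ ≤ r + σ by linarith)
        linarith
      have h3 : completionDelay ρ (r + σ) (x - ∫ v in r..(r + σ), ρ v) ≤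
          ENNReal.ofReal (τ - σ) := by
        apply completionDelay_le (by linarith)
        have := hρ.integral_add r (r + σ) (r + τ)
        rw [show r + σ + (τ - σ) = r + τ by ring]
        linarith
      calc _ ≤ ENNReal.ofReal σ + ENNReal.ofReal (τ - σ) := by gcongr
        _ = ENNReal.ofReal τ := by
          rw [← ENNReal.ofReal_add hσ (by linarith)]; congr 1; ring

/-- Change of time scale: running the rate `ρ` from time `a` on at speed `s`. -/
theorem completionDelay_scale {s : ℝ} (hs : 0 < s) (a : ℝ) :
    completionDelay (fun v => ρ (a + v / s)) 0 x =
      ENNReal.ofReal s * completionDelay (fun t => s * ρ t) a x := by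
  have key : ∀ τ, ∫ v in (0:ℝ)..(0 + s * τ), ρ (a + v / s) = ∫ v in a..(a + τ), s * ρ v := by
    intro τ
    rw [intervalIntegral.integral_const_mul, intervalIntegral.integral_comp_add_div _ hs.ne']
    simp [hs.ne']
  have hs' : ENNReal.ofReal s ≠ 0 := by simpa using hs
  apply le_antisymm
  · rw [mul_comm, ← ENNReal.div_le_iff hs' ENNReal.ofReal_ne_top]
    refine le_completionDelay fun τ h0 h1 => ?_
    rw [ENNReal.div_le_iff hs' ENNReal.ofReal_ne_top, mul_comm, ← ENNReal.ofReal_mul hs.le]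
    exact completionDelay_le (by positivity) (by rw [key]; exact h1)
  · refine le_completionDelay fun τ h0 h1 => ?_
    have : completionDelay (fun t => s * ρ t) a x ≤ ENNReal.ofReal (τ / s) := by
      apply completionDelay_le (by positivity)
      rw [← key]
      rwa [mul_div_cancel₀ _ hs.ne']
    calc _ ≤ ENNReal.ofReal s * ENNReal.ofReal (τ / s) := by gcongr
      _ = ENNReal.ofReal τ := by rw [← ENNReal.ofReal_mul hs.le, mul_div_cancel₀ _ hs.ne']

/-- A delay truncated at `σ` sees only the rates before `r + σ`; this lets two schedules be
concatenated without changing the cost of the first phase. -/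
theorem min_completionDelay_congr (hρ : IsRate ρ) (hρ' : IsRate ρ')
    (h : ∀ t, r ≤ t → t < r + σ → ρ t = ρ' t) :
    min (completionDelay ρ r x) (ENNReal.ofReal σ) =
      min (completionDelay ρ' r x) (ENNReal.ofReal σ) := by
  have key : ∀ ρ ρ' : ℝ → ℝ, IsRate ρ → IsRate ρ' →
      (∀ t, r ≤ t → t < r + σ → ρ t = ρ' t) →
      min (completionDelay ρ r x) (ENNReal.ofReal σ) ≤ completionDelay ρ' r x := by
    intro ρ ρ' hρ hρ' h
    refine le_completionDelay fun τ h0 h1 => ?_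
    rcases le_total σ τ with h2 | h2
    · exact (min_le_right _ _).trans (ENNReal.ofReal_le_ofReal h2)
    · refine (min_le_left _ _).trans (completionDelay_le h0 (h1.trans_eq ?_))
      rw [intervalIntegral.integral_of_le (by linarith), intervalIntegral.integral_of_le (by linarith),
        integral_Ioc_eq_integral_Ioo, integral_Ioc_eq_integral_Ioo]
      refine setIntegral_congr_fun measurableSet_Ioo fun t ht => ?_
      exact (h t ht.1.le (by linarith [ht.2])).symm
  apply le_antisymm
  · exact le_min (key ρ ρ' hρ hρ' h) (min_le_right _ _)
  · exact le_min (key ρ' ρ hρ' hρ fun t a b => (h t a b).symm) (min_le_right _ _)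

theorem IsRate.min_completionDelay_add (hρ : IsRate ρ) (hσ : 0 ≤ σ) (hτ : 0 ≤ τ) :
    min (completionDelay ρ r x) (ENNReal.ofReal (σ + τ)) =
      min (completionDelay ρ r x) (ENNReal.ofReal σ) +
        min (completionDelay ρ (r + σ) (max (x - ∫ v in r..(r + σ), ρ v) 0))
          (ENNReal.ofReal τ) := by
  have h := hρ.completionDelay_split (r := r) (x := x) hσ
  set D := completionDelay ρ r x
  set D' := completionDelay ρ (r + σ) (max (x - ∫ v in r..(r + σ), ρ v) 0)
  rw [ENNReal.ofReal_add hσ hτ]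
  rcases le_total D (ENNReal.ofReal σ) with h1 | h1
  · rw [min_eq_left h1] at h ⊢
    have h2 : D' = 0 := by
      have hD : D ≠ ⊤ := ne_top_of_le_ne_top ENNReal.ofReal_ne_top h1
      have : D + 0 = D + D' := by rw [add_zero]; exact h
      exact ((ENNReal.add_right_inj hD).1 this).symm
    rw [h2, min_eq_left (h1.trans le_self_add)]
    simp
  · rw [min_eq_right h1] at h ⊢
    rw [h, min_add_add_left]

end Delay

/-! ### The residual optimum and its decrease over a short time -/

namespace SchedulingProblem

variable {Ω : Type u} {Pb : SchedulingProblem Ω}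

theorem exists_rate_bound (Pb : SchedulingProblem Ω) (j : Job Ω) :
    ∃ B : ℝ, 0 < B ∧ ∀ z ∈ Pb.rates, z j ≤ B := by
  obtain ⟨B, hB⟩ := (Pb.isCompact_rates.image (continuous_apply j)).bddAbove
  exact ⟨max B 1, by positivity, fun z hz =>
    (hB (Set.mem_image_of_mem _ hz)).trans (le_max_left _ _)⟩

namespace IsSchedule

variable {z z' : ℝ → Job Ω → ℝ}

theorem isRate (hz : Pb.IsSchedule z) (j : Job Ω) : IsRate (fun t => z t j) := by
  obtain ⟨B, hB0, hB⟩ := Pb.exists_rate_bound j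
  have h0 : ∀ t, 0 ≤ z t j := fun t => Pb.rates_nonneg _ (hz.2 t) j
  refine ⟨h0, fun a b => ?_⟩
  refine (intervalIntegrable_const (c := B)).mono_fun
    (measurable_pi_iff.1 hz.1 j).aestronglyMeasurable (ae_of_all _ fun t => ?_)
  simp only [Real.norm_eq_abs, abs_of_nonneg (h0 t), abs_of_pos hB0]
  exact hB _ (hz.2 t)

theorem comp (hz : Pb.IsSchedule z) {φ : ℝ → ℝ} (hφ : Measurable φ) :
    Pb.IsSchedule (fun t => z (φ t)) :=
  ⟨hz.1.comp hφ, fun t => hz.2 (φ t)⟩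

theorem const {y : Job Ω → ℝ} (hy : y ∈ Pb.rates) : Pb.IsSchedule (fun _ => y) :=
  ⟨measurable_const, fun _ => hy⟩

theorem ite (hz : Pb.IsSchedule z) (hz' : Pb.IsSchedule z') (σ : ℝ) :
    Pb.IsSchedule (fun t => if t < σ then z t else z' t) :=
  ⟨Measurable.ite measurableSet_Iio hz.1 hz'.1, fun t => by
    by_cases h : t < σ
    · simpa [h] using hz.2 t
    · simpa [h] using hz'.2 t⟩

theorem integral_le (hz : Pb.IsSchedule z) {j : Job Ω} {B : ℝ} (hB : ∀ y ∈ Pb.rates, y j ≤ B)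
    {a b : ℝ} (hab : a ≤ b) : ∫ v in a..b, z v j ≤ B * (b - a) := by
  have := intervalIntegral.integral_mono_on hab ((hz.isRate j).integrable a b)
    (intervalIntegrable_const (c := B)) (fun t _ => hB _ (hz.2 t))
  simpa [mul_comm] using this

end IsSchedule

/-- Total weighted completion time of the jobs of `S` with sizes `x`, all available at time `0`,
in the schedule `z` at unit speed. -/
def completionCost (Pb : SchedulingProblem Ω) (S : Finset (Job Ω)) (z : ℝ → Job Ω → ℝ)
    (x : Job Ω → ℝ) : ℝ≥0∞ :=
  ∑ j ∈ S, (Pb.weight j.1 : ℝ≥0∞) * completionDelay (fun t => z t j) 0 (x j)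

/-- What remains of the sizes `x` when `z` is run for `σ` units of time. -/
def leftover (z : ℝ → Job Ω → ℝ) (σ : ℝ) (x : Job Ω → ℝ) (j : Job Ω) : ℝ :=
  max (x j - ∫ v in (0 : ℝ)..σ, z v j) 0

/-- Total weighted time that the jobs of `S` spend in the system up to time `σ`. -/
def partialCost (Pb : SchedulingProblem Ω) (S : Finset (Job Ω)) (z : ℝ → Job Ω → ℝ)
    (σ : ℝ) (x : Job Ω → ℝ) : ℝ≥0∞ :=
  ∑ j ∈ S, (Pb.weight j.1 : ℝ≥0∞) *
    min (completionDelay (fun t => z t j) 0 (x j)) (ENNReal.ofReal σ)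

/-- Total weight of the unfinished jobs. -/
def aliveWeight (Pb : SchedulingProblem Ω) (S : Finset (Job Ω)) (x : Job Ω → ℝ) : ℝ≥0∞ :=
  ∑ j ∈ S, (Pb.weight j.1 : ℝ≥0∞) * (if 0 < x j then 1 else 0)

variable {S S' : Finset (Job Ω)} {x y : Job Ω → ℝ} {z z' : ℝ → Job Ω → ℝ} {σ : ℝ}

theorem residualOptimum_le_completionCost (hz : Pb.IsSchedule z) :
    Pb.residualOptimum S x ≤ Pb.completionCost S z x :=
  iInf₂_le z hz

theorem residualOptimum_mono (h : ∀ j ∈ S, x j ≤ y j) :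
    Pb.residualOptimum S x ≤ Pb.residualOptimum S y :=
  le_iInf₂ fun _ hz => (residualOptimum_le_completionCost hz).trans <|
    Finset.sum_le_sum fun j hj => mul_le_mul_right (completionDelay_mono (h j hj)) _

theorem residualOptimum_congr (h : ∀ j ∈ S, x j = y j) :
    Pb.residualOptimum S x = Pb.residualOptimum S y :=
  le_antisymm (residualOptimum_mono fun j hj => (h j hj).le)
    (residualOptimum_mono fun j hj => (h j hj).ge)

/-- Jobs that are finished or have weight `0` do not contribute to the residual optimum. -/
theorem residualOptimum_of_subset (hS : S ⊆ S')
    (h : ∀ j ∈ S', j ∉ S → x j ≤ 0 ∨ Pb.weight j.1 = 0) :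
    Pb.residualOptimum S' x = Pb.residualOptimum S x := by
  unfold residualOptimum
  congr 1; ext z; congr 1; ext hz
  symm
  refine Finset.sum_subset hS fun j hj hj' => ?_
  rcases h j hj hj' with h | h
  · rw [completionDelay_of_nonpos h, mul_zero]
  · simp [h]

theorem exists_mem_rates_pos (Pb : SchedulingProblem Ω) (S : Finset (Job Ω)) :
    ∃ y ∈ Pb.rates, ∀ j ∈ S, 0 < y j := by
  classical
  induction S using Finset.induction_on with
  | empty => exact ⟨0, Pb.zero_mem, by simp⟩
  | insert a S _ ih =>
    obtain ⟨y, hy, hpos⟩ := ih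
    obtain ⟨y', hy', hpos'⟩ := Pb.exists_pos a
    refine ⟨(1 / 2 : ℝ) • y + (1 / 2 : ℝ) • y',
      Pb.convex_rates hy hy' (by norm_num) (by norm_num) (by norm_num), fun j hj => ?_⟩
    have h1 := Pb.rates_nonneg y hy j
    have h2 := Pb.rates_nonneg y' hy' j
    simp only [Pi.add_apply, Pi.smul_apply, smul_eq_mul]
    rcases Finset.mem_insert.1 hj with rfl | hj
    · linarith
    · linarith [hpos j hj]

theorem residualOptimum_ne_top (Pb : SchedulingProblem Ω) (S : Finset (Job Ω)) (x : Job Ω → ℝ) :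
    Pb.residualOptimum S x ≠ ⊤ := by
  obtain ⟨y, hy, hpos⟩ := Pb.exists_mem_rates_pos S
  refine ne_top_of_le_ne_top ?_ (residualOptimum_le_completionCost (IsSchedule.const hy))
  refine ENNReal.sum_ne_top.2 fun j hj => ENNReal.mul_ne_top ENNReal.coe_ne_top ?_
  refine ne_top_of_le_ne_top ENNReal.ofReal_ne_top
    (completionDelay_le (τ := |x j| / y j) (div_nonneg (abs_nonneg _) (hpos j hj).le) ?_)
  simp only [intervalIntegral.integral_const, zero_add, sub_zero, smul_eq_mul]
  rw [div_mul_cancel₀ _ (hpos j hj).ne']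
  exact le_abs_self _

theorem completionCost_split (hz : Pb.IsSchedule z) (hσ : 0 ≤ σ) :
    Pb.completionCost S z x = Pb.partialCost S z σ x +
      Pb.completionCost S (fun t => z (σ + t)) (leftover z σ x) := by
  unfold completionCost partialCost
  rw [← Finset.sum_add_distrib]
  refine Finset.sum_congr rfl fun j _ => ?_
  rw [← mul_add]
  congr 1
  rw [(hz.isRate j).completionDelay_split (r := 0) (x := x j) hσ]
  congr 1
  · rw [← (hz.isRate j).completionDelay_split (r := 0) (x := x j) hσ]
  · have := completionDelay_scale (ρ := fun t => z t j) (x := leftover z σ x j) one_pos σ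
    simp only [div_one, ENNReal.ofReal_one, one_mul] at this
    rw [this, zero_add]
    rfl

/-- Running any schedule for `σ` units of time and continuing optimally. -/
theorem residualOptimum_le_leftover (hz : Pb.IsSchedule z) (hσ : 0 ≤ σ) :
    Pb.residualOptimum S x ≤
      Pb.residualOptimum S (leftover z σ x) + Pb.partialCost S z σ x := by
  rw [residualOptimum.eq_def Pb S (leftover z σ x), ENNReal.iInf_add]
  refine le_iInf fun z' => ?_
  rw [ENNReal.iInf_add]
  refine le_iInf fun hz' => ?_
  -- The concatenation: `z` up to time `σ`, then `z'` started afresh.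
  have hc := hz.ite (hz'.comp (measurable_id.sub_const σ)) σ
  refine (residualOptimum_le_completionCost hc).trans_eq ?_
  rw [completionCost_split hc hσ, add_comm]
  congr 1
  · refine Finset.sum_congr rfl fun j _ => ?_
    congr 1
    have : leftover (fun t => if t < σ then z t else z' (id t - σ)) σ x j = leftover z σ x j := by
      unfold leftover
      congr 2
      -- The concatenation already follows `z'` at the time `σ` itself, so the endpoint is removed
      -- from the integrals.
      rw [intervalIntegral.integral_of_le hσ, intervalIntegral.integral_of_le hσ,
        integral_Ioc_eq_integral_Ioo, integral_Ioc_eq_integral_Ioo]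
      refine setIntegral_congr_fun measurableSet_Ioo fun t ht => ?_
      simp [ht.2]
    rw [this]
    refine completionDelay_congr fun t ht => ?_
    simp [not_lt.2 ht]
  · refine Finset.sum_congr rfl fun j _ => ?_
    congr 1
    refine min_completionDelay_congr (hc.isRate j) (hz.isRate j) fun t _ ht => ?_
    simp [show t < σ by simpa using ht]

theorem residualOptimum_leftover_add_le (hz : Pb.IsSchedule z) (hσ : 0 ≤ σ) :
    Pb.residualOptimum S (leftover z σ x) + Pb.partialCost S z σ x ≤
      Pb.completionCost S z x := by
  rw [completionCost_split hz hσ, add_comm]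
  gcongr
  exact residualOptimum_le_completionCost (hz.comp (measurable_const_add σ))

theorem partialCost_ne_top : Pb.partialCost S z σ x ≠ ⊤ :=
  ENNReal.sum_ne_top.2 fun _ _ => ENNReal.mul_ne_top ENNReal.coe_ne_top
    (ne_top_of_le_ne_top ENNReal.ofReal_ne_top (min_le_right _ _))

/-- The tail of an optimal schedule is optimal. -/
theorem completionCost_tail_le (hz : Pb.IsSchedule z) (hσ : 0 ≤ σ)
    (hopt : Pb.completionCost S z x ≤ Pb.residualOptimum S x) :
    Pb.completionCost S (fun t => z (σ + t)) (leftover z σ x) ≤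
      Pb.residualOptimum S (leftover z σ x) := by
  have h := hopt.trans (residualOptimum_le_leftover hz hσ)
  rw [completionCost_split hz hσ, add_comm] at h
  exact (ENNReal.add_le_add_iff_right partialCost_ne_top).1 h

theorem partialCost_le (z : ℝ → Job Ω → ℝ) :
    Pb.partialCost S z σ x ≤ ENNReal.ofReal σ * Pb.aliveWeight S x := by
  unfold partialCost aliveWeight
  rw [Finset.mul_sum]
  refine Finset.sum_le_sum fun j _ => ?_
  split_ifs with h
  · rw [mul_one, mul_comm]
    gcongr
    exact min_le_right _ _
  · rw [completionDelay_of_nonpos (not_lt.1 h)]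
    simp

/-- Rates are bounded, uniformly over all schedules, so for small `σ` no unfinished job can complete
before `σ` and each contributes its weight times the full `σ`. This is the converse of
`partialCost_le`. -/
theorem eventually_le_partialCost (Pb : SchedulingProblem Ω) (S : Finset (Job Ω))
    (x : Job Ω → ℝ) : ∀ᶠ σ : ℝ in 𝓝[>] 0, ∀ z, Pb.IsSchedule z →
      ENNReal.ofReal σ * Pb.aliveWeight S x ≤ Pb.partialCost S z σ x := by
  have h : ∀ j ∈ S, ∀ᶠ σ : ℝ in 𝓝[>] 0, ∀ z, Pb.IsSchedule z → 0 < x j →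
      ENNReal.ofReal σ ≤ completionDelay (fun t => z t j) 0 (x j) := by
    intro j _
    obtain ⟨B, hB0, hB⟩ := Pb.exists_rate_bound j
    by_cases hx : 0 < x j
    · filter_upwards [Ioo_mem_nhdsGT (show 0 < x j / B by positivity)] with σ hσ z hz _
      refine (hz.isRate j).ofReal_le_completionDelay ?_
      rw [zero_add]
      calc _ ≤ B * (σ - 0) := hz.integral_le hB hσ.1.le
        _ < x j := by rw [sub_zero, mul_comm]; exact (lt_div_iff₀ hB0).1 hσ.2
    · exact Eventually.of_forall fun σ z _ h => absurd h hx
  filter_upwards [(Filter.eventually_all_finset S).2 h] with σ hσ z hz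
  unfold partialCost aliveWeight
  rw [Finset.mul_sum]
  refine Finset.sum_le_sum fun j hj => ?_
  split_ifs with h
  · rw [mul_one, mul_comm, min_eq_right (hσ j hj z hz h)]
  · simp

/-- Running `y` for `σ` units of time decreases the residual optimum by at most `σ` times the total
weight of the unfinished jobs. -/
theorem residualOptimum_le_const (hy : y ∈ Pb.rates) (hσ : 0 ≤ σ) :
    Pb.residualOptimum S x ≤ Pb.residualOptimum S (fun j => max (x j - σ * y j) 0) +
      ENNReal.ofReal σ * Pb.aliveWeight S x := by
  refine (residualOptimum_le_leftover (IsSchedule.const hy) hσ).trans ?_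
  gcongr
  · apply residualOptimum_mono
    intro j _
    simp [leftover]
  · exact partialCost_le _

open scoped Classical in
/-- Averages of schedules, restricted to finitely many jobs, are feasible. -/
theorem IsSchedule.average_mem (hz : Pb.IsSchedule z) (S : Finset (Job Ω)) {a b : ℝ}
    (hab : a < b) :
    (fun j => if j ∈ S then (b - a)⁻¹ * ∫ v in a..b, z v j else 0) ∈ Pb.rates := by
  -- Extension by zero transfers the claim to the finite-dimensional space `S → ℝ`, where averages
  -- of functions with values in a closed convex set stay in it; downward closure makes the
  -- truncated vectors feasible.
  let E : (S → ℝ) → Job Ω → ℝ := fun v j => if h : j ∈ S then v ⟨j, h⟩ else 0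
  have hE : Continuous E := by
    refine continuous_pi fun j => ?_
    by_cases h : j ∈ S
    · simpa [E, h] using continuous_apply _
    · simpa [E, h] using continuous_const
  have hconv : Convex ℝ (E ⁻¹' Pb.rates) := by
    intro u hu v hv p q hp hq hpq
    have e : E (p • u + q • v) = p • E u + q • E v := by
      ext j
      by_cases h : j ∈ S <;> simp [E, h]
    rw [Set.mem_preimage, e]
    exact Pb.convex_rates hu hv hp hq hpq
  have hclosed : IsClosed (E ⁻¹' Pb.rates) := Pb.isCompact_rates.isClosed.preimage hE
  have hint : ∀ j : S, IntegrableOn (fun t => z t j) (Set.Ioc a b) := fun j =>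
    (intervalIntegrable_iff_integrableOn_Ioc_of_le hab.le).1 ((hz.isRate j).integrable a b)
  have hvol : (volume : Measure ℝ) (Set.Ioc a b) = ENNReal.ofReal (b - a) := Real.volume_Ioc
  have hmem := hconv.set_average_mem (μ := volume) (t := Set.Ioc a b)
    (f := fun t (j : S) => z t j) hclosed (by simpa [hvol] using hab) (by simp [hvol])
    (ae_of_all _ fun t => Pb.downward_closed _ (hz.2 t) _ fun j => by
      have := Pb.rates_nonneg _ (hz.2 t) j
      by_cases h : j ∈ S <;> simp [E, h, this])
    (Integrable.of_eval hint)
  have hmem' : E _ ∈ Pb.rates := hmem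
  convert hmem' using 1
  ext j
  by_cases h : j ∈ S
  · simp only [h, if_true, E, dif_pos]
    rw [setAverage_eq, Pi.smul_apply, eval_integral hint,
      intervalIntegral.integral_of_le hab.le, Measure.real, hvol, ENNReal.toReal_ofReal (by linarith)]
    simp
  · simp [h, E]

end SchedulingProblem

/-! ### Existence of optimal schedules -/

namespace SchedulingProblem

variable {Ω : Type u} {Pb : SchedulingProblem Ω}

open scoped Classical in
/-- Cumulative processing functions all of whose mean rates are feasible come from a schedule. -/
theorem exists_isSchedule_of_slopes {S : Finset (Job Ω)} {L : Job Ω → ℝ → ℝ}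
    (hlip : ∀ j, ∃ K : ℝ≥0, LipschitzWith K (L j))
    (hslope : ∀ a b, a < b →
      (fun j => if j ∈ S then (b - a)⁻¹ * (L j b - L j a) else 0) ∈ Pb.rates) :
    ∃ z, Pb.IsSchedule z ∧ ∀ j ∈ S, ∀ a b, ∫ v in a..b, z v j = L j b - L j a := by
  -- By Lipschitz continuity almost every time is good. There the derivatives are limits of feasible
  -- slopes, hence feasible; elsewhere the rate is set to 0.
  let good : Set ℝ := ⋂ i ∈ S, {t | DifferentiableAt ℝ (L i) t}
  have hgood : ∀ᵐ t, t ∈ good := by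
    simp only [good, Set.mem_iInter]
    refine (Filter.eventually_all_finset S).2 fun i _ => ?_
    obtain ⟨K, hK⟩ := hlip i
    exact hK.ae_differentiableAt_real
  have hmeas : MeasurableSet good :=
    S.measurableSet_biInter fun i _ => measurableSet_of_differentiableAt ℝ (L i)
  refine ⟨fun t j => if j ∈ S then good.indicator (deriv (L j)) t else 0, ⟨?_, fun t => ?_⟩,
    fun j hj a b => ?_⟩
  · refine measurable_pi_iff.2 fun j => ?_
    by_cases h : j ∈ S
    · simpa [h] using (measurable_deriv (L j)).indicator hmeas
    · simp [h]
  · by_cases ht : t ∈ good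
    · refine Pb.isCompact_rates.isClosed.mem_of_tendsto (b := 𝓝[>] (0 : ℝ))
        (f := fun h j => if j ∈ S then (t + h - t)⁻¹ * (L j (t + h) - L j t) else 0) ?_ ?_
      · refine tendsto_pi_nhds.2 fun j => ?_
        by_cases h : j ∈ S
        · have hd : DifferentiableAt ℝ (L j) t := Set.mem_iInter₂.1 ht j h
          simpa [h, ht] using hd.hasDerivAt.tendsto_slope_zero_right
        · simp [h]
      · filter_upwards [self_mem_nhdsWithin] with h hh
        exact hslope t (t + h) (by simpa using hh)
    · simpa [ht, Pi.zero_def] using Pb.zero_mem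
  · obtain ⟨K, hK⟩ := hlip j
    rw [← (hK.lipschitzOnWith.absolutelyContinuousOnInterval (a := a) (b := b)).integral_deriv_eq_sub]
    refine intervalIntegral.integral_congr_ae ?_
    filter_upwards [hgood] with t ht _
    simp [hj, ht]

/-- Limits are taken of the cumulative processing of a minimizing sequence, rather than of its
rates. Mean rates over intervals stay feasible in the limit, so the limit comes from a schedule, and
completion delays are lower semicontinuous. -/
theorem exists_optimal_schedule (Pb : SchedulingProblem Ω) (S : Finset (Job Ω)) (x : Job Ω → ℝ) :
    ∃ z, Pb.IsSchedule z ∧ Pb.completionCost S z x ≤ Pb.residualOptimum S x := by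
  classical
  have happrox : ∀ n : ℕ, ∃ z, Pb.IsSchedule z ∧
      Pb.completionCost S z x < Pb.residualOptimum S x + ((n : ℝ≥0∞) + 1)⁻¹ := by
    intro n
    have := ENNReal.lt_add_right (Pb.residualOptimum_ne_top S x)
      (show ((n : ℝ≥0∞) + 1)⁻¹ ≠ 0 by simp)
    obtain ⟨z, h⟩ := iInf_lt_iff.1 this
    obtain ⟨hz, h⟩ := iInf_lt_iff.1 h
    exact ⟨z, hz, h⟩
  choose zs hzs hcost using happrox
  -- An ultrafilter gives limits for all jobs and times simultaneously, with no extraction of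
  -- subsequences.
  let U : Ultrafilter ℕ := Filter.hyperfilter ℕ
  have hU : (U : Filter ℕ) ≤ atTop := Nat.hyperfilter_le_atTop
  choose B hB0 hB using Pb.exists_rate_bound
  have hinc : ∀ n j a b, |∫ v in a..b, zs n v j| ≤ B j * |b - a| := by
    intro n j a b
    have := intervalIntegral.norm_integral_le_of_norm_le_const (a := a) (b := b)
      (f := fun v => zs n v j) (C := B j) fun v _ => by
        rw [Real.norm_eq_abs, abs_of_nonneg (Pb.rates_nonneg _ ((hzs n).2 v) j)]
        exact hB j _ ((hzs n).2 v)
    simpa using this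
  have hlim : ∀ j t, ∃ l, Tendsto (fun n => ∫ v in (0 : ℝ)..t, zs n v j) U (𝓝 l) := by
    intro j t
    have hc : IsCompact (Set.Icc (-(B j * |t|)) (B j * |t|)) := isCompact_Icc
    obtain ⟨l, _, hl⟩ := hc.ultrafilter_le_nhds' (U.map fun n => ∫ v in (0 : ℝ)..t, zs n v j)
      (Ultrafilter.mem_map.2 <| Filter.univ_mem' fun n => by
        have := hinc n j 0 t
        rw [sub_zero] at this
        exact abs_le.1 this)
    exact ⟨l, hl⟩
  choose L hL using hlim
  have hdiff : ∀ j a b, Tendsto (fun n => ∫ v in a..b, zs n v j) U (𝓝 (L j b - L j a)) := by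
    intro j a b
    refine ((hL j b).sub (hL j a)).congr fun n => ?_
    have := ((hzs n).isRate j).integral_add 0 a b
    linarith
  obtain ⟨z, hz, hzL⟩ := exists_isSchedule_of_slopes (Pb := Pb) (S := S) (L := L)
    (fun j => ⟨(B j).toNNReal, LipschitzWith.of_dist_le_mul fun b a => by
      rw [Real.dist_eq, Real.dist_eq, Real.coe_toNNReal _ (hB0 j).le]
      exact le_of_tendsto (hdiff j a b).abs (Eventually.of_forall fun n => hinc n j a b)⟩)
    (fun a b hab => Pb.isCompact_rates.isClosed.mem_of_tendsto (b := (U : Filter ℕ))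
      (f := fun n j => if j ∈ S then (b - a)⁻¹ * ∫ v in a..b, zs n v j else 0)
      (tendsto_pi_nhds.2 fun j => by
        by_cases h : j ∈ S
        · simpa [h] using (hdiff j a b).const_mul ((b - a)⁻¹)
        · simp [h])
      (Eventually.of_forall fun n => (hzs n).average_mem S hab))
  have hD : ∀ j, ∃ D : ℝ≥0∞,
      Tendsto (fun n => completionDelay (fun t => zs n t j) 0 (x j)) U (𝓝 D) := by
    intro j
    obtain ⟨D, _, hD⟩ := isCompact_univ.ultrafilter_le_nhds
      (U.map fun n => completionDelay (fun t => zs n t j) 0 (x j)) (by simp)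
    exact ⟨D, hD⟩
  choose D hD using hD
  -- If `q` exceeds the limit delay, almost all approximants have completed `j` by time `q`, and
  -- this inequality passes to the limit.
  have hzD : ∀ j ∈ S, completionDelay (fun t => z t j) 0 (x j) ≤ D j := by
    intro j hj
    refine le_of_forall_gt fun c hc => ?_
    obtain ⟨q, hq1, hq2⟩ := ENNReal.lt_iff_exists_nnreal_btwn.1 hc
    refine lt_of_le_of_lt ?_ hq2
    rw [← ENNReal.ofReal_coe_nnreal] at hq1 ⊢
    refine completionDelay_le q.2 ?_
    rw [zero_add, hzL j hj]
    refine ge_of_tendsto (hdiff j 0 q) ?_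
    filter_upwards [(hD j).eventually_lt_const hq1] with n hn
    simpa using ((hzs n).isRate j).le_integral_of_completionDelay_lt hn
  refine ⟨z, hz, ?_⟩
  calc Pb.completionCost S z x ≤ ∑ j ∈ S, (Pb.weight j.1 : ℝ≥0∞) * D j :=
        Finset.sum_le_sum fun j hj => mul_le_mul_right (hzD j hj) _
    _ ≤ Pb.residualOptimum S x := by
      have h1 : Tendsto (fun n => Pb.completionCost S (zs n) x) U
          (𝓝 (∑ j ∈ S, (Pb.weight j.1 : ℝ≥0∞) * D j)) :=
        tendsto_finsetSum _ fun j _ => ENNReal.Tendsto.const_mul (hD j) (Or.inr ENNReal.coe_ne_top)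
      have h2 : Tendsto (fun n : ℕ => Pb.residualOptimum S x + ((n : ℝ≥0∞) + 1)⁻¹) U
          (𝓝 (Pb.residualOptimum S x + 0)) := by
        refine Tendsto.mono_left (tendsto_const_nhds.add ?_) hU
        exact_mod_cast (tendsto_add_atTop_iff_nat 1).2 ENNReal.tendsto_inv_nat_nhds_zero
      rw [add_zero] at h2
      exact le_of_tendsto_of_tendsto' h1 h2 fun n => (hcost n).le

end SchedulingProblem

/-! ### Restricted instances and the online algorithm -/

theorem max_max_sub_sub {p a b : ℝ} (hb : 0 ≤ b) : max (max (p - a) 0 - b) 0 = max (p - (a + b)) 0 := by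
  rcases le_total (p - a) 0 with h | h
  · rw [max_eq_right h, max_eq_right (by linarith), max_eq_right (by linarith)]
  · rw [max_eq_left h, sub_sub]

namespace SchedulingInstance

variable {Ω : Type u} {I I' : SchedulingInstance Ω} {T t r : ℝ}

/-- The jobs that are released by time `t`. -/
def present (I : SchedulingInstance Ω) (t : ℝ) : Finset (Job Ω) :=
  I.jobs.filter fun j => I.release j ≤ t

open scoped Classical in
/-- The instance that consists of the jobs released before time `r`. -/
def before (I : SchedulingInstance Ω) (r : ℝ) : SchedulingInstance Ω where
  jobs := I.jobs.filter fun j => I.release j < r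
  release j := if j ∈ I.jobs ∧ I.release j < r then I.release j else 0
  size j := if j ∈ I.jobs ∧ I.release j < r then I.size j else 0
  release_nonneg j hj := by
    rw [if_pos (Finset.mem_filter.1 hj)]
    exact I.release_nonneg j (Finset.mem_filter.1 hj).1
  size_pos j hj := by
    rw [if_pos (Finset.mem_filter.1 hj)]
    exact I.size_pos j (Finset.mem_filter.1 hj).1

theorem mem_present {j : Job Ω} : j ∈ I.present t ↔ j ∈ I.jobs ∧ I.release j ≤ t :=
  Finset.mem_filter

theorem agreeBefore_before (I : SchedulingInstance Ω) (r : ℝ) : (I.before r).AgreeBefore I r := by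
  constructor
  · intro j
    simp only [before, Finset.mem_filter]
    constructor
    · exact fun h => h.1
    · intro h
      exact ⟨h, by rw [if_pos h]; exact h.2⟩
  · intro j hj _
    have h := Finset.mem_filter.1 hj
    exact ⟨if_pos h, if_pos h⟩

theorem AgreeBefore.mono (h : I.AgreeBefore I' T) (htT : t ≤ T) : I.AgreeBefore I' t := by
  refine ⟨fun j => ⟨fun hj => ?_, fun hj => ?_⟩, fun j hj hr => h.2 j hj (by linarith)⟩
  · have h1 := h.2 j hj.1 (by linarith)
    exact ⟨((h.1 j).1 ⟨hj.1, by linarith⟩).1, by linarith⟩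
  · have h0 := (h.1 j).2 ⟨hj.1, by linarith⟩
    have h1 := h.2 j h0.1 h0.2
    exact ⟨h0.1, by linarith⟩

/-- Equality of the structures holds because `before` resets the irrelevant data outside its jobs to
0. Online consistency thereby reduces to rewriting. -/
theorem AgreeBefore.before_eq (h : I.AgreeBefore I' r) : I.before r = I'.before r := by
  unfold before
  congr 1
  · ext j
    simpa only [Finset.mem_filter] using h.1 j
  · ext j
    by_cases hj : j ∈ I.jobs ∧ I.release j < r
    · rw [if_pos hj, if_pos ((h.1 j).1 hj)]
      exact (h.2 j hj.1 hj.2).1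
    · rw [if_neg hj, if_neg (mt (h.1 j).2 hj)]
  · ext j
    by_cases hj : j ∈ I.jobs ∧ I.release j < r
    · rw [if_pos hj, if_pos ((h.1 j).1 hj)]
      exact (h.2 j hj.1 hj.2).2
    · rw [if_neg hj, if_neg (mt (h.1 j).2 hj)]

theorem AgreeBefore.present_eq (h : I.AgreeBefore I' T) (ht : t < T) :
    I.present t = I'.present t := by
  ext j
  rw [mem_present, mem_present]
  constructor
  · intro hj
    have h1 := h.2 j hj.1 (by linarith)
    exact ⟨((h.1 j).1 ⟨hj.1, by linarith⟩).1, by linarith⟩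
  · intro hj
    have h0 := (h.1 j).2 ⟨hj.1, by linarith⟩
    have h1 := h.2 j h0.1 h0.2
    exact ⟨h0.1, by linarith⟩

theorem eventually_present_eq (I : SchedulingInstance Ω) (t : ℝ) :
    ∀ᶠ h : ℝ in 𝓝[>] 0, I.present (t + h) = I.present t := by
  have : ∀ j ∈ I.jobs, ∀ᶠ h : ℝ in 𝓝[>] 0, I.release j ≤ t + h → I.release j ≤ t := by
    intro j _
    rcases le_or_gt (I.release j) t with h | h
    · exact Eventually.of_forall fun _ _ => h
    · filter_upwards [Ioo_mem_nhdsGT (show 0 < I.release j - t by linarith)] with x hx hx'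
      linarith [hx.2]
  filter_upwards [(Filter.eventually_all_finset I.jobs).2 this, self_mem_nhdsWithin] with h hh h0
  have h0 : 0 < h := h0
  ext j
  rw [mem_present, mem_present]
  exact ⟨fun hj => ⟨hj.1, hh j hj.1 hj.2⟩, fun hj => ⟨hj.1, by linarith⟩⟩

end SchedulingInstance

namespace SchedulingProblem

variable {Ω : Type u} {Pb : SchedulingProblem Ω} {I : SchedulingInstance Ω}
  {S : Finset (Job Ω)} {s : ℝ} {x : Job Ω → ℝ} {z : ℝ → Job Ω → ℝ}

/-- There is a rate vector that decreases the residual optimum at the rate of the total weight of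
the unfinished jobs. -/
theorem eventually_exists_rate (Pb : SchedulingProblem Ω) (S : Finset (Job Ω)) (x : Job Ω → ℝ) :
    ∀ᶠ σ : ℝ in 𝓝[>] 0, ∃ y ∈ Pb.rates,
      Pb.residualOptimum S (fun j => max (x j - σ * y j) 0) +
        ENNReal.ofReal σ * Pb.aliveWeight S x ≤ Pb.residualOptimum S x := by
  classical
  obtain ⟨z, hz, hopt⟩ := Pb.exists_optimal_schedule S x
  filter_upwards [Pb.eventually_le_partialCost S x, self_mem_nhdsWithin] with σ hσ h0
  have h0 : 0 < σ := h0
  -- The witness is the mean rate of an optimal schedule over `[0, σ]`, which leaves the same sizes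
  -- at time `σ` as that schedule.
  refine ⟨_, hz.average_mem S h0, le_trans ?_ hopt⟩
  refine le_trans ?_ (residualOptimum_leftover_add_le hz h0.le)
  refine add_le_add (residualOptimum_mono fun j hj => ?_) (hσ z hz)
  simp only [hj, if_true, leftover]
  rw [sub_zero, ← mul_assoc, mul_inv_cancel₀ h0.ne', one_mul]

theorem remaining_of_release_le {t : ℝ} {j : Job Ω} (h : I.release j ≤ t) :
    remaining I s z t j = max (I.size j - ∫ v in (I.release j)..t, s * z v j) 0 := if_pos h

theorem remaining_of_lt_release {t : ℝ} {j : Job Ω} (h : t < I.release j) :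
    remaining I s z t j = 0 := if_neg (not_le.2 h)

theorem remaining_nonneg (I : SchedulingInstance Ω) (s : ℝ) (z : ℝ → Job Ω → ℝ) (t : ℝ)
    (j : Job Ω) : 0 ≤ remaining I s z t j := by
  unfold remaining
  split_ifs
  · exact le_max_right _ _
  · exact le_rfl

theorem remaining_advance (hz : Pb.IsSchedule z) (hs : 0 ≤ s) {a b : ℝ} {j : Job Ω}
    (h : I.release j ≤ a) (hab : a ≤ b) :
    remaining I s z b j = max (remaining I s z a j - ∫ v in a..b, s * z v j) 0 := by
  have hρ := (hz.isRate j).const_mul hs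
  rw [remaining_of_release_le h, remaining_of_release_le (h.trans hab),
    max_max_sub_sub (hρ.integral_nonneg hab), hρ.integral_add]

theorem residualOptimum_jobs {t : ℝ} {x : Job Ω → ℝ}
    (hx : ∀ j, t < I.release j → x j ≤ 0) :
    Pb.residualOptimum I.jobs x = Pb.residualOptimum (I.present t) x := by
  refine residualOptimum_of_subset (Finset.filter_subset _ _) fun j hj hj' => Or.inl (hx j ?_)
  by_contra! hc
  exact hj' (SchedulingInstance.mem_present.2 ⟨hj, hc⟩)

/-- A schedule that is optimal for the jobs of `S` with the sizes `x`. -/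
def optimalSchedule (Pb : SchedulingProblem Ω) (S : Finset (Job Ω)) (x : Job Ω → ℝ) :
    ℝ → Job Ω → ℝ :=
  (Pb.exists_optimal_schedule S x).choose

theorem isSchedule_optimalSchedule : Pb.IsSchedule (Pb.optimalSchedule S x) :=
  (Pb.exists_optimal_schedule S x).choose_spec.1

theorem completionCost_optimalSchedule :
    Pb.completionCost S (Pb.optimalSchedule S x) x ≤ Pb.residualOptimum S x :=
  (Pb.exists_optimal_schedule S x).choose_spec.2

open scoped Classical in
/-- The remaining sizes at time `r` of the jobs of `J`, all of them released by time `r`, in the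
schedule `z`. -/
def sizesAt (s : ℝ) (J : Finset (Job Ω)) (release size : Job Ω → ℝ) (z : ℝ → Job Ω → ℝ) (r : ℝ)
    (j : Job Ω) : ℝ :=
  if j ∈ J then max (size j - ∫ v in (release j)..r, s * z v j) 0 else 0

theorem sizesAt_congr {J J' : Finset (Job Ω)} {rel rel' siz siz' : Job Ω → ℝ}
    {z z' : ℝ → Job Ω → ℝ} {r r' : ℝ} (hJ : J = J') (hr : r = r')
    (h : ∀ j ∈ J, rel j = rel' j ∧ siz j = siz' j ∧ rel j ≤ r) (hz : ∀ t < r, z t = z' t) :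
    sizesAt s J rel siz z r = sizesAt s J' rel' siz' z' r' := by
  subst hJ hr
  ext j
  unfold sizesAt
  split_ifs with hj
  · obtain ⟨h1, h2, h3⟩ := h j hj
    rw [← h1, ← h2]
    congr 2
    rw [intervalIntegral.integral_of_le h3, intervalIntegral.integral_of_le h3,
      integral_Ioc_eq_integral_Ioo, integral_Ioc_eq_integral_Ioo]
    refine setIntegral_congr_fun measurableSet_Ioo fun t ht => ?_
    simp only [hz t ht.2]
  · rfl

/-- The online algorithm: whenever jobs are released, recompute an optimal schedule for the
remaining sizes, and follow it at speed `s`. -/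
def onlineSchedule (Pb : SchedulingProblem Ω) (s : ℝ) (I : SchedulingInstance Ω) (t : ℝ) :
    Job Ω → ℝ :=
  if h : (I.present t).Nonempty then
    Pb.optimalSchedule (I.present t)
      (sizesAt s (I.present t) I.release I.size
        (fun v => onlineSchedule Pb s (I.before ((I.present t).sup' h I.release)) v)
        ((I.present t).sup' h I.release))
      (s * (t - (I.present t).sup' h I.release))
  else 0
termination_by I.jobs.card
decreasing_by
  -- The recursion ends because a job attaining the latest release time is not released strictly
  -- before it.
  obtain ⟨j, hj, hjr⟩ := (I.present t).exists_mem_eq_sup' h I.release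
  refine Finset.card_lt_card (Finset.filter_ssubset.2 ⟨j, ?_, ?_⟩)
  · exact (SchedulingInstance.mem_present.1 hj).1
  · rw [hjr]
    exact lt_irrefl _

theorem isOnline_onlineSchedule (Pb : SchedulingProblem Ω) (s : ℝ) :
    IsOnline (Pb.onlineSchedule s) := by
  intro I I' T hI t ht
  have hP := hI.present_eq ht
  rw [onlineSchedule, onlineSchedule]
  by_cases h : (I.present t).Nonempty
  · have h' : (I'.present t).Nonempty := hP ▸ h
    rw [dif_pos h, dif_pos h']
    have hrel : ∀ j ∈ I.present t, I.release j = I'.release j ∧ I.size j = I'.size j := by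
      intro j hj
      have hj := SchedulingInstance.mem_present.1 hj
      exact hI.2 j hj.1 (by linarith)
    have hr : (I.present t).sup' h I.release = (I'.present t).sup' h' I'.release :=
      Finset.sup'_congr h hP fun j hj => (hrel j (hP ▸ hj)).1
    have hrt : (I.present t).sup' h I.release ≤ t :=
      Finset.sup'_le h _ fun j hj => (SchedulingInstance.mem_present.1 hj).2
    have hx := sizesAt_congr (s := s) hP hr
      (fun j hj => ⟨(hrel j hj).1, (hrel j hj).2, Finset.le_sup' I.release hj⟩)
      (z := fun v => onlineSchedule Pb s (I.before ((I.present t).sup' h I.release)) v)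
      (z' := fun v => onlineSchedule Pb s (I'.before ((I'.present t).sup' h' I'.release)) v)
      (fun v _ => by rw [(hI.mono (hrt.trans ht.le)).before_eq, hr])
    rw [hx, hr, hP]
  · rw [dif_neg h, dif_neg (hP ▸ h)]

/-- The definition computes the past from the instance cut off at the last release; by the online
property this is the past of the schedule itself. Until the next release one fixed optimal schedule
is followed. -/
theorem onlineSchedule_of_present_eq {t t' : ℝ} (h : (I.present t).Nonempty)
    (ht : I.present t' = I.present t) :
    Pb.onlineSchedule s I t' = Pb.optimalSchedule (I.present t)
      (sizesAt s (I.present t) I.release I.size (Pb.onlineSchedule s I)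
        ((I.present t).sup' h I.release))
      (s * (t' - (I.present t).sup' h I.release)) := by
  rw [onlineSchedule, dif_pos (ht ▸ h)]
  simp only [ht]
  congr 1
  refine sizesAt_congr rfl rfl (fun j hj => ⟨rfl, rfl, ?_⟩) fun v hv => ?_
  · exact Finset.le_sup' I.release hj
  exact isOnline_onlineSchedule Pb s _ _ _ (I.agreeBefore_before _) v hv

theorem isSchedule_onlineSchedule (Pb : SchedulingProblem Ω) (s : ℝ) (I : SchedulingInstance Ω) :
    Pb.IsSchedule (Pb.onlineSchedule s I) := by
  classical
  constructor
  · intro M hM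
    -- Only finitely many sets of present jobs occur; on each the schedule is 0 or a fixed
    -- measurable schedule composed with an affine map of time.
    have hpiece : ∀ J : Finset (Job Ω),
        MeasurableSet {t | I.present t = J ∧ Pb.onlineSchedule s I t ∈ M} := by
      intro J
      have hJ : MeasurableSet {t | I.present t = J} := by
        by_cases hs : J ⊆ I.jobs
        · have : {t | I.present t = J} = ⋂ j ∈ I.jobs, {t | I.release j ≤ t ↔ j ∈ J} := by
            ext t
            simp only [Set.mem_ofPred_eq, Set.mem_iInter, Finset.ext_iff,
              SchedulingInstance.mem_present]
            exact ⟨fun h j hj => by simpa [hj] using h j, fun h j =>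
              ⟨fun hj => (h j hj.1).1 hj.2, fun hj => ⟨hs hj, (h j (hs hj)).2 hj⟩⟩⟩
          rw [this]
          refine I.jobs.measurableSet_biInter fun j _ => ?_
          by_cases hj : j ∈ J
          · convert measurableSet_Ici (a := I.release j) using 1
            ext t
            simp [hj]
          · convert measurableSet_Iio (a := I.release j) using 1
            ext t
            simp [hj]
        · convert MeasurableSet.empty
          ext t
          simp only [Set.mem_ofPred_eq, Set.mem_empty_iff_false, iff_false]
          rintro rfl
          exact hs (Finset.filter_subset _ _)
      by_cases hne : ∃ t₀, I.present t₀ = J ∧ J.Nonempty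
      · obtain ⟨t₀, rfl, h⟩ := hne
        have hm := (isSchedule_optimalSchedule (Pb := Pb) (S := I.present t₀)
          (x := sizesAt s (I.present t₀) I.release I.size (Pb.onlineSchedule s I)
            ((I.present t₀).sup' h I.release))).1.comp
          (measurable_id.sub_const ((I.present t₀).sup' h I.release) |>.const_mul s)
        convert hJ.inter (hm hM) using 1
        ext t
        simp only [Set.mem_ofPred_eq, Set.mem_inter_iff, Set.mem_preimage, Function.comp, id]
        refine and_congr_right fun ht => ?_
        rw [onlineSchedule_of_present_eq h ht]
      · convert hJ.inter (MeasurableSet.const ((0 : Job Ω → ℝ) ∈ M)) using 1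
        ext t
        simp only [Set.mem_ofPred_eq, Set.mem_inter_iff]
        refine and_congr_right fun ht => ?_
        rw [onlineSchedule, dif_neg]
        exact fun h => hne ⟨t, ht, ht ▸ h⟩
    convert I.jobs.powerset.measurableSet_biUnion fun J _ => hpiece J using 1
    ext t
    simp only [Set.mem_preimage, Set.mem_iUnion, Set.mem_ofPred_eq, Finset.mem_powerset]
    exact ⟨fun h => ⟨_, Finset.filter_subset _ _, rfl, h⟩, fun ⟨_, _, _, h⟩ => h⟩
  · intro t
    rw [onlineSchedule]
    split_ifs
    · exact isSchedule_optimalSchedule.2 _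
    · exact Pb.zero_mem

theorem leftover_add (hz : Pb.IsSchedule z) {σ τ : ℝ} (hτ : 0 ≤ τ) (j : Job Ω) :
    leftover z (σ + τ) x j = leftover (fun t => z (σ + t)) τ (leftover z σ x) j := by
  unfold leftover
  have h : ∫ v in (0 : ℝ)..τ, z (σ + v) j = ∫ v in σ..(σ + τ), z v j := by
    rw [intervalIntegral.integral_comp_add_left (fun v => z v j), add_zero]
  rw [h, max_max_sub_sub ((hz.isRate j).integral_nonneg (by linarith)), (hz.isRate j).integral_add]

/-- Following an optimal schedule decreases the residual optimum as fast as possible. -/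
theorem eventually_leftover_le (hz : Pb.IsSchedule z)
    (hopt : Pb.completionCost S z x ≤ Pb.residualOptimum S x) {σ : ℝ} (hσ : 0 ≤ σ) :
    ∀ᶠ τ : ℝ in 𝓝[>] 0, ∀ y ∈ Pb.rates, Pb.residualOptimum S (leftover z (σ + τ) x) ≤
      Pb.residualOptimum S (fun j => max (leftover z σ x j - τ * y j) 0) := by
  filter_upwards [Pb.eventually_le_partialCost S (leftover z σ x), self_mem_nhdsWithin]
    with τ hτ h0 y hy
  have h0 : 0 < τ := h0
  have hz' := hz.comp (φ := fun t => σ + t) (measurable_const_add σ)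
  have hW : ENNReal.ofReal τ * Pb.aliveWeight S (leftover z σ x) ≠ ⊤ :=
    ne_top_of_le_ne_top partialCost_ne_top (hτ _ hz')
  refine (ENNReal.add_le_add_iff_right hW).1 ?_
  calc _ ≤ Pb.residualOptimum S (leftover (fun t => z (σ + t)) τ (leftover z σ x)) +
        Pb.partialCost S (fun t => z (σ + t)) τ (leftover z σ x) :=
        add_le_add (residualOptimum_mono fun j _ => (leftover_add hz h0.le j).le) (hτ _ hz')
    _ ≤ Pb.completionCost S (fun t => z (σ + t)) (leftover z σ x) :=
        residualOptimum_leftover_add_le hz' h0.le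
    _ ≤ Pb.residualOptimum S (leftover z σ x) := completionCost_tail_le hz hσ hopt
    _ ≤ _ := residualOptimum_le_const hy h0.le

theorem tendsto_const_mul_nhdsGT_zero {s : ℝ} (hs : 0 < s) :
    Tendsto (fun h => s * h) (𝓝[>] 0) (𝓝[>] 0) := by
  refine tendsto_nhdsWithin_iff.2 ⟨?_, ?_⟩
  · have : Tendsto (fun h => s * h) (𝓝 0) (𝓝 (s * 0)) := tendsto_id.const_mul s
    rw [mul_zero] at this
    exact this.mono_left nhdsWithin_le_nhds
  · filter_upwards [self_mem_nhdsWithin] with h hh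
    exact mul_pos hs hh

theorem isGradientDescent_onlineSchedule (Pb : SchedulingProblem Ω) {s : ℝ} (hs : 0 < s)
    (I : SchedulingInstance Ω) : Pb.IsGradientDescent I s (Pb.onlineSchedule s I) := by
  have hz := isSchedule_onlineSchedule Pb s I
  refine ⟨hz, ae_of_all _ fun t η _ => ?_⟩
  have hzero : ∀ t', ∀ j, t' < I.release j →
      remaining I s (Pb.onlineSchedule s I) t' j ≤ 0 := fun t' j hj =>
    (remaining_of_lt_release hj).le
  have hzero' : ∀ h > 0, ∀ y ∈ Pb.rates, ∀ j, t < I.release j →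
      max (remaining I s (Pb.onlineSchedule s I) t j - s * h * y j) 0 ≤ 0 := by
    intro h hh y hy j hj
    have := Pb.rates_nonneg y hy j
    rw [remaining_of_lt_release hj, max_le_iff, zero_sub, neg_nonpos]
    exact ⟨by positivity, le_rfl⟩
  by_cases hne : (I.present t).Nonempty
  · set J := I.present t with hJ
    set r := J.sup' hne I.release with hr
    set x := sizesAt s J I.release I.size (Pb.onlineSchedule s I) r with hx
    have hrt : r ≤ t := Finset.sup'_le hne _ fun j hj => (SchedulingInstance.mem_present.1 hj).2
    have hrel : ∀ j ∈ J, I.release j ≤ r := fun j hj => Finset.le_sup' I.release hj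
    have hpres : ∀ t', r ≤ t' → t' ≤ t → I.present t' = J := by
      intro t' h1 h2
      ext j
      rw [SchedulingInstance.mem_present]
      constructor
      · exact fun h => SchedulingInstance.mem_present.2 ⟨h.1, h.2.trans h2⟩
      · exact fun h => ⟨(SchedulingInstance.mem_present.1 h).1, (hrel j h).trans h1⟩
    -- Since the last release `r`, the algorithm has run the optimal schedule for `s * (t' - r)`
    -- units of its own time.
    have hleft : ∀ t', r ≤ t' → (∀ v, r ≤ v → v ≤ t' → I.present v = J) → ∀ j ∈ J,
        remaining I s (Pb.onlineSchedule s I) t' j =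
          leftover (Pb.optimalSchedule J x) (s * (t' - r)) x j := by
      intro t' ht' hv j hj
      rw [remaining_advance hz hs.le (hrel j hj) ht', remaining_of_release_le (hrel j hj)]
      unfold leftover
      congr 2
      · simp [hx, sizesAt, hj]
      · have h1 : ∫ v in r..t', s * Pb.onlineSchedule s I v j =
            ∫ v in r..t', s * Pb.optimalSchedule J x (s * (v - r)) j := by
          refine intervalIntegral.integral_congr fun v hv' => ?_
          rw [Set.uIcc_of_le ht'] at hv'
          simp only [onlineSchedule_of_present_eq hne (hv v hv'.1 hv'.2)]
          rfl
        rw [h1, intervalIntegral.integral_const_mul,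
          intervalIntegral.integral_comp_sub_right
            (fun v => Pb.optimalSchedule J x (s * v) j) r,
          intervalIntegral.integral_comp_mul_left (fun v => Pb.optimalSchedule J x v j) hs.ne']
        simp [hs.ne']
    have hmain := (tendsto_const_mul_nhdsGT_zero hs).eventually
      (eventually_leftover_le isSchedule_optimalSchedule completionCost_optimalSchedule
        (Pb := Pb) (S := J) (x := x) (σ := s * (t - r)) (mul_nonneg hs.le (by linarith)))
    filter_upwards [hmain, I.eventually_present_eq t, self_mem_nhdsWithin] with h hh hp h0 y hy
    have h0 : 0 < h := h0
    rw [residualOptimum_jobs (hzero (t + h)), residualOptimum_jobs (hzero' h h0 y hy), hp]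
    refine le_trans (le_of_eq ?_) ((hh y hy).trans (le_trans (le_of_eq ?_) le_self_add))
    · refine residualOptimum_congr fun j hj => ?_
      rw [hleft (t + h) (by linarith) (fun v h1 h2 => ?_) j hj]
      · congr 1; ring
      · rcases le_total v t with h3 | h3
        · exact hpres v h1 h3
        · apply le_antisymm
          · rw [hJ, ← hp]
            exact fun i hi => SchedulingInstance.mem_present.2
              ⟨(SchedulingInstance.mem_present.1 hi).1,
                (SchedulingInstance.mem_present.1 hi).2.trans h2⟩
          · exact fun i hi => SchedulingInstance.mem_present.2
              ⟨(SchedulingInstance.mem_present.1 hi).1, (hrel i hi).trans h1⟩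
    · refine residualOptimum_congr fun j hj => ?_
      rw [hleft t hrt hpres j hj]
  · filter_upwards [I.eventually_present_eq t] with h hp y _
    rw [residualOptimum_jobs (hzero (t + h)), hp, Finset.not_nonempty_iff_eq_empty.1 hne]
    refine (residualOptimum_le_completionCost (IsSchedule.const Pb.zero_mem)).trans ?_
    simp [completionCost]

end SchedulingProblem

/-! ### The rate of decrease under gradient descent -/

/-- A Lipschitz function whose upper right Dini derivative is nonpositive almost everywhere does
not increase. -/
theorem LipschitzOnWith.le_of_ae_dini_nonpos {F : ℝ → ℝ} {K : ℝ≥0} {a b : ℝ} (hab : a ≤ b)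
    (hF : LipschitzOnWith K F (Set.Icc a b))
    (hd : ∀ᵐ t, t ∈ Set.Ioo a b → ∀ η : ℝ, 0 < η → ∀ᶠ h : ℝ in 𝓝[>] 0, F (t + h) ≤ F t + η * h) :
    F b ≤ F a := by
  rw [← Set.uIcc_of_le hab] at hF
  have hac := hF.absolutelyContinuousOnInterval
  have hint := hac.integral_deriv_eq_sub
  have : ∫ t in a..b, deriv F t ≤ 0 := by
    rw [intervalIntegral.integral_of_le hab, integral_Ioc_eq_integral_Ioo]
    refine integral_nonpos_of_ae ((ae_restrict_iff' measurableSet_Ioo).2 ?_)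
    filter_upwards [hd, hac.ae_differentiableAt] with t ht hdiff htab
    have hdiff := hdiff (by rw [Set.uIcc_of_le hab]; exact ⟨htab.1.le, htab.2.le⟩)
    refine le_of_forall_pos_le_add fun η hη => ?_
    rw [Pi.zero_apply, zero_add]
    refine le_of_tendsto hdiff.hasDerivAt.tendsto_slope_zero_right ?_
    filter_upwards [ht htab η hη, self_mem_nhdsWithin] with h hh h0
    have h0 : 0 < h := h0
    rw [smul_eq_mul, inv_mul_le_iff₀ h0]
    linarith
  linarith

namespace SchedulingProblem

variable {Ω : Type u} {Pb : SchedulingProblem Ω} {I : SchedulingInstance Ω}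
  {S : Finset (Job Ω)} {s : ℝ} {x : Job Ω → ℝ} {z o : ℝ → Job Ω → ℝ}

/-- The residual optimum as a real number. -/
def resOpt (Pb : SchedulingProblem Ω) (S : Finset (Job Ω)) (x : Job Ω → ℝ) : ℝ :=
  (Pb.residualOptimum S x).toReal

theorem resOpt_nonneg : 0 ≤ Pb.resOpt S x := ENNReal.toReal_nonneg

theorem resOpt_empty : Pb.resOpt ∅ x = 0 := by
  have : Pb.residualOptimum ∅ x ≤ 0 := by
    simpa [completionCost] using residualOptimum_le_completionCost (S := ∅) (x := x)
      (IsSchedule.const Pb.zero_mem)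
  simp [resOpt, le_antisymm this zero_le]

theorem resOpt_mono {y : Job Ω → ℝ} (h : ∀ j ∈ S, x j ≤ y j) : Pb.resOpt S x ≤ Pb.resOpt S y :=
  ENNReal.toReal_mono (Pb.residualOptimum_ne_top S y) (residualOptimum_mono h)

theorem resOpt_congr {y : Job Ω → ℝ} (h : ∀ j ∈ S, x j = y j) : Pb.resOpt S x = Pb.resOpt S y :=
  congrArg ENNReal.toReal (residualOptimum_congr h)

/-- Time that job `j` spends in the system up to time `t`. -/
def spent (I : SchedulingInstance Ω) (s : ℝ) (z : ℝ → Job Ω → ℝ) (t : ℝ) (j : Job Ω) : ℝ :=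
  (min (completionDelay (fun t => s * z t j) (I.release j) (I.size j))
    (ENNReal.ofReal (t - I.release j))).toReal

theorem spent_nonneg {t : ℝ} {j : Job Ω} : 0 ≤ spent I s z t j := ENNReal.toReal_nonneg

theorem spent_release {j : Job Ω} : spent I s z (I.release j) j = 0 := by
  simp [spent]

theorem spent_sub (hz : Pb.IsSchedule z) (hs : 0 ≤ s) {a b : ℝ} {j : Job Ω}
    (h : I.release j ≤ a) (hab : a ≤ b) :
    (min (completionDelay (fun t => s * z t j) a (remaining I s z a j))
      (ENNReal.ofReal (b - a))).toReal = spent I s z b j - spent I s z a j := by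
  have := ((hz.isRate j).const_mul hs).min_completionDelay_add (r := I.release j) (x := I.size j)
    (σ := a - I.release j) (τ := b - a) (by linarith) (by linarith)
  rw [show a - I.release j + (b - a) = b - I.release j by ring,
    show I.release j + (a - I.release j) = a by ring] at this
  rw [remaining_of_release_le h]
  unfold spent
  rw [this, ENNReal.toReal_add, add_sub_cancel_left]
  all_goals exact ne_top_of_le_ne_top ENNReal.ofReal_ne_top (min_le_right _ _)

theorem spent_sub_le (hz : Pb.IsSchedule z) (hs : 0 ≤ s) {a b : ℝ} {j : Job Ω}
    (h : I.release j ≤ a) (hab : a ≤ b) :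
    spent I s z b j - spent I s z a j ≤
      (b - a) * (if 0 < remaining I s z a j then 1 else 0) := by
  rw [← spent_sub hz hs h hab]
  split_ifs with hr
  · rw [mul_one]
    exact ENNReal.toReal_le_of_le_ofReal (by linarith) (min_le_right _ _)
  · rw [completionDelay_of_nonpos (not_lt.1 hr)]
    simp

/-- The weighted time that the jobs of `S` spend in the system up to time `t`. -/
def weightedSpent (Pb : SchedulingProblem Ω) (I : SchedulingInstance Ω) (s : ℝ)
    (z : ℝ → Job Ω → ℝ) (S : Finset (Job Ω)) (t : ℝ) : ℝ :=
  ∑ j ∈ S, (Pb.weight j.1 : ℝ) * spent I s z t j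

theorem toReal_aliveWeight : (Pb.aliveWeight S x).toReal =
    ∑ j ∈ S, (Pb.weight j.1 : ℝ) * (if 0 < x j then 1 else 0) := by
  unfold aliveWeight
  rw [ENNReal.toReal_sum]
  · refine Finset.sum_congr rfl fun j _ => ?_
    split_ifs <;> simp
  · intro j _
    split_ifs <;> simp

theorem aliveWeight_ne_top : Pb.aliveWeight S x ≠ ⊤ :=
  ENNReal.sum_ne_top.2 fun j _ => by split_ifs <;> simp

theorem weightedSpent_sub_le (hz : Pb.IsSchedule z) (hs : 0 ≤ s) {a b : ℝ}
    (h : ∀ j ∈ S, I.release j ≤ a) (hab : a ≤ b) :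
    Pb.weightedSpent I s z S b - Pb.weightedSpent I s z S a ≤
      (b - a) * (Pb.aliveWeight S (remaining I s z a)).toReal := by
  rw [toReal_aliveWeight, Finset.mul_sum, weightedSpent, weightedSpent, ← Finset.sum_sub_distrib]
  refine Finset.sum_le_sum fun j hj => ?_
  rw [← mul_sub, mul_left_comm]
  exact mul_le_mul_of_nonneg_left (spent_sub_le hz hs (h j hj) hab) (Pb.weight j.1).2

/-- Running `y` at speed `c` from time `a` to time `b` decreases the residual optimum by at most
`c` times the weighted time that the jobs spend in the system meanwhile. -/
theorem resOpt_le_run {y : ℝ → Job Ω → ℝ} (hy : Pb.IsSchedule y) {c a b : ℝ} (hc : 0 < c)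
    (hab : a ≤ b) :
    Pb.resOpt S x ≤ Pb.resOpt S (fun j => max (x j - ∫ v in a..b, c * y v j) 0) +
      ∑ j ∈ S, (Pb.weight j.1 : ℝ) * (c * (min (completionDelay (fun t => c * y t j) a (x j))
        (ENNReal.ofReal (b - a))).toReal) := by
  have hφ : Measurable fun v : ℝ => a + v / c := by fun_prop
  have h := residualOptimum_le_leftover (S := S) (x := x) (hy.comp hφ)
    (mul_nonneg hc.le (sub_nonneg.2 hab))
  have hleft : leftover (fun v => y (a + v / c)) (c * (b - a)) x =
      fun j => max (x j - ∫ v in a..b, c * y v j) 0 := by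
    ext j
    unfold leftover
    rw [intervalIntegral.integral_const_mul,
      intervalIntegral.integral_comp_add_div (fun v => y v j) hc.ne']
    simp [hc.ne']
  rw [hleft] at h
  have h' := ENNReal.toReal_mono
    (ENNReal.add_ne_top.2 ⟨Pb.residualOptimum_ne_top _ _, partialCost_ne_top⟩) h
  rw [ENNReal.toReal_add (Pb.residualOptimum_ne_top _ _) partialCost_ne_top] at h'
  refine h'.trans_eq ?_
  congr 1
  unfold partialCost
  rw [ENNReal.toReal_sum fun j _ => ENNReal.mul_ne_top ENNReal.coe_ne_top
    (ne_top_of_le_ne_top ENNReal.ofReal_ne_top (min_le_right _ _))]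
  refine Finset.sum_congr rfl fun j _ => ?_
  have hm : Monotone fun d : ℝ≥0∞ => ENNReal.ofReal c * d := fun _ _ h => mul_le_mul_right h _
  rw [completionDelay_scale (ρ := fun t => y t j) hc, ENNReal.ofReal_mul hc.le, ← hm.map_min]
  simp [ENNReal.toReal_mul, hc.le]

theorem resOpt_remaining_le (hz : Pb.IsSchedule z) (hs : 0 < s) {a b : ℝ}
    (h : ∀ j ∈ S, I.release j ≤ a) (hab : a ≤ b) :
    Pb.resOpt S (remaining I s z a) ≤ Pb.resOpt S (remaining I s z b) +
      s * (Pb.weightedSpent I s z S b - Pb.weightedSpent I s z S a) := by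
  refine (resOpt_le_run hz hs hab).trans_eq ?_
  congr 1
  · exact resOpt_congr fun j hj => (remaining_advance hz hs.le (h j hj) hab).symm
  · rw [weightedSpent, weightedSpent, ← Finset.sum_sub_distrib, Finset.mul_sum]
    refine Finset.sum_congr rfl fun j hj => ?_
    rw [spent_sub hz hs.le (h j hj) hab]
    ring

theorem resOpt_remaining_antitone (hz : Pb.IsSchedule z) (hs : 0 ≤ s) {a b : ℝ}
    (h : ∀ j ∈ S, I.release j ≤ a) (hab : a ≤ b) :
    Pb.resOpt S (remaining I s z b) ≤ Pb.resOpt S (remaining I s z a) := by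
  refine resOpt_mono fun j hj => ?_
  rw [remaining_advance hz hs (h j hj) hab]
  have := ((hz.isRate j).const_mul hs).integral_nonneg hab
  exact max_le (by linarith) (remaining_nonneg _ _ _ _ _)

/-- While no job is released, gradient descent at speed `s` decreases the residual optimum at a
rate of at least `s` times the weight of the unfinished jobs. -/
theorem IsGradientDescent.resOpt_add_le (hgd : Pb.IsGradientDescent I s z) (hs : 0 < s) {a b : ℝ}
    (ha : 0 ≤ a) (hab : a ≤ b) (hSI : S ⊆ I.jobs) (h : ∀ j ∈ S, I.release j ≤ a)
    (h' : ∀ j ∈ I.jobs, j ∉ S → b ≤ I.release j) :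
    Pb.resOpt S (remaining I s z b) + s * Pb.weightedSpent I s z S b ≤
      Pb.resOpt S (remaining I s z a) + s * Pb.weightedSpent I s z S a := by
  obtain ⟨hz, hgd⟩ := hgd
  let W : ℝ := ∑ j ∈ S, (Pb.weight j.1 : ℝ)
  have hW : 0 ≤ W := Finset.sum_nonneg fun j _ => (Pb.weight j.1).2
  have halive : ∀ t, (Pb.aliveWeight S (remaining I s z t)).toReal ≤ W := by
    intro t
    rw [toReal_aliveWeight]
    refine Finset.sum_le_sum fun j _ => ?_
    have := (Pb.weight j.1).2
    split_ifs <;> simp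
  -- Lipschitz continuity is what allows the gradient descent condition, known only at almost every
  -- time, to be integrated.
  have hlip : ∀ u v, a ≤ u → u ≤ v →
      |(Pb.resOpt S (remaining I s z v) + s * Pb.weightedSpent I s z S v) -
        (Pb.resOpt S (remaining I s z u) + s * Pb.weightedSpent I s z S u)| ≤ s * W * (v - u) := by
    intro u v hu huv
    have hS : ∀ j ∈ S, I.release j ≤ u := fun j hj => (h j hj).trans hu
    have h1 := resOpt_remaining_le hz hs hS huv
    have h2 := resOpt_remaining_antitone hz hs.le hS huv
    have h3 := weightedSpent_sub_le hz hs.le hS huv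
    have h4 := mul_le_mul_of_nonneg_left (halive u) (sub_nonneg.2 huv)
    have h5 := mul_le_mul_of_nonneg_left (h3.trans h4) hs.le
    rw [abs_le]
    constructor
    · have : 0 ≤ s * W * (v - u) := mul_nonneg (mul_nonneg hs.le hW) (by linarith)
      linarith
    · linarith
  refine LipschitzOnWith.le_of_ae_dini_nonpos (K := (s * W).toNNReal)
    (F := fun t => Pb.resOpt S (remaining I s z t) + s * Pb.weightedSpent I s z S t) hab
    (LipschitzOnWith.of_dist_le_mul fun v hv u hu => ?_) ?_
  · rw [Real.coe_toNNReal _ (mul_nonneg hs.le hW), Real.dist_eq, Real.dist_eq]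
    rcases le_total u v with huv | huv
    · rw [abs_of_nonneg (sub_nonneg.2 huv)]
      exact hlip u v hu.1 huv
    · rw [abs_sub_comm, abs_sub_comm v u, abs_of_nonneg (sub_nonneg.2 huv)]
      exact hlip v u hv.1 huv
  · filter_upwards [(ae_restrict_iff' measurableSet_Ici).1 hgd] with t ht hta η hη
    have hS : ∀ j ∈ S, I.release j ≤ t := fun j hj => (h j hj).trans hta.1.le
    filter_upwards [ht (ha.trans hta.1.le) η hη,
      (tendsto_const_mul_nhdsGT_zero hs).eventually
        (Pb.eventually_exists_rate S (remaining I s z t)),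
      Ioo_mem_nhdsGT (show 0 < b - t by linarith [hta.2])] with τ h1 h2 hτ
    -- Gradient descent is compared with the `y` that achieves the full decrease `s * τ` times the
    -- unfinished weight.
    obtain ⟨y, hy, h2⟩ := h2
    have h1 := h1 y hy
    have hunrel : ∀ j ∈ I.jobs, j ∉ S → t + τ < I.release j := fun j hj hjS => by
      linarith [h' j hj hjS, hτ.2]
    rw [residualOptimum_of_subset hSI fun j hj hjS => Or.inl
        (remaining_of_lt_release (hunrel j hj hjS)).le,
      residualOptimum_of_subset hSI (x := fun j => max _ _) fun j hj hjS => Or.inl (by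
        have h0 := Pb.rates_nonneg y hy j
        have h3 := mul_nonneg (mul_nonneg hs.le hτ.1.le) h0
        rw [remaining_of_lt_release (by linarith [hunrel j hj hjS, hτ.1])]
        exact max_le (by linarith) le_rfl)] at h1
    have h3 := (add_le_add_left h1 (ENNReal.ofReal (s * τ) *
      Pb.aliveWeight S (remaining I s z t)))
    rw [add_right_comm] at h3
    have h4 := h3.trans (add_le_add_left h2 _)
    have htop : ENNReal.ofReal (s * τ) * Pb.aliveWeight S (remaining I s z t) ≠ ⊤ :=
      ENNReal.mul_ne_top ENNReal.ofReal_ne_top aliveWeight_ne_top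
    have h5 := ENNReal.toReal_mono
      (ENNReal.add_ne_top.2 ⟨Pb.residualOptimum_ne_top _ _, ENNReal.ofReal_ne_top⟩) h4
    rw [ENNReal.toReal_add (Pb.residualOptimum_ne_top _ _) htop,
      ENNReal.toReal_add (Pb.residualOptimum_ne_top _ _) ENNReal.ofReal_ne_top,
      ENNReal.toReal_mul, ENNReal.toReal_ofReal (mul_nonneg hs.le hτ.1.le),
      ENNReal.toReal_ofReal (mul_nonneg hη.le hτ.1.le)] at h5
    have h6 := mul_le_mul_of_nonneg_left (weightedSpent_sub_le hz hs.le hS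
      (show t ≤ t + τ by linarith [hτ.1])) hs.le
    rw [add_sub_cancel_left] at h6
    change Pb.resOpt S _ + _ ≤ Pb.resOpt S _ + _ at h5
    linarith

end SchedulingProblem

/-! ### Two copies of the jobs and the effect of a release -/

/-- Exchange of the labels `0, ..., N - 1` with the labels `N, ..., 2N - 1`. -/
def blockSwap (N : ℕ) : Equiv.Perm ℕ :=
  Function.Involutive.toPerm (fun n => if n < N then n + N else if n < 2 * N then n - N else n) <| by
    intro n
    dsimp only
    split_ifs <;> omega

theorem blockSwap_apply (N n : ℕ) :
    blockSwap N n = if n < N then n + N else if n < 2 * N then n - N else n := rfl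

namespace SchedulingProblem

variable {Ω : Type u} {Pb : SchedulingProblem Ω} {I : SchedulingInstance Ω}
  {S J : Finset (Job Ω)} {s : ℝ} {x : Job Ω → ℝ} {z o : ℝ → Job Ω → ℝ} {N : ℕ}

/-- The second copy of a job. -/
def copy (N : ℕ) : Equiv.Perm (Job Ω) := Equiv.prodCongr (Equiv.refl Ω) (blockSwap N)

theorem copy_fst (j : Job Ω) : (copy N j).1 = j.1 := rfl

theorem copy_copy (j : Job Ω) : copy N (copy N j) = j := by
  have : blockSwap N (blockSwap N j.2) = j.2 := by
    simp only [blockSwap_apply]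
    split_ifs <;> omega
  exact Prod.ext rfl this

theorem le_copy_snd {j : Job Ω} (hj : j.2 < N) : N ≤ (copy N j).2 := by
  simp [copy, blockSwap_apply, hj]

/-- The vector that is `u` on the jobs with labels less than `N` and `v` on their copies. -/
def joint (N : ℕ) (u v : Job Ω → ℝ) (j : Job Ω) : ℝ := if j.2 < N then u j else v (copy N j)

variable {u v : Job Ω → ℝ}

theorem joint_left {j : Job Ω} (hj : j.2 < N) : joint N u v j = u j := if_pos hj

theorem joint_copy {j : Job Ω} (hj : j.2 < N) : joint N u v (copy N j) = v j := by
  rw [joint, if_neg (not_lt.2 (le_copy_snd hj)), copy_copy]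

/-- By symmetry under copies, `o` may be moved to the second copies; the joint vector is then
dominated by a convex combination of feasible vectors. -/
theorem IsSchedule.joint (hz : Pb.IsSchedule z) (ho : Pb.IsSchedule o) {p q : ℝ} (hp : 0 ≤ p)
    (hq : 0 ≤ q) (hpq : p + q = 1) :
    Pb.IsSchedule (fun t => joint N (fun j => p * z t j) (fun j => q * o t j)) := by
  refine ⟨measurable_pi_iff.2 fun j => ?_, fun t => ?_⟩
  · by_cases hj : j.2 < N
    · simpa [SchedulingProblem.joint, hj] using (measurable_pi_iff.1 hz.1 j).const_mul p
    · simpa [SchedulingProblem.joint, hj] using (measurable_pi_iff.1 ho.1 (copy N j)).const_mul q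
  · have h := Pb.convex_rates (hz.2 t) (Pb.copies_symm (copy N) copy_fst _ (ho.2 t)) hp hq hpq
    refine Pb.downward_closed _ h _ fun j => ?_
    have h1 := mul_nonneg hp (Pb.rates_nonneg _ (hz.2 t) j)
    have h2 := mul_nonneg hq (Pb.rates_nonneg _ (ho.2 t) (copy N j))
    simp only [Pi.add_apply, Pi.smul_apply, smul_eq_mul, SchedulingProblem.joint]
    split_ifs
    · exact ⟨h1, by linarith⟩
    · exact ⟨h2, by linarith⟩

open scoped Classical in
/-- The jobs of `J` together with their second copies. -/
def withCopies (N : ℕ) (J : Finset (Job Ω)) : Finset (Job Ω) := J ∪ J.map (copy N).toEmbedding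

theorem mem_withCopies {j : Job Ω} : j ∈ withCopies N J ↔ j ∈ J ∨ ∃ i ∈ J, copy N i = j := by
  simp only [withCopies, Finset.mem_union, Finset.mem_map]
  rfl

theorem sum_withCopies (hN : ∀ j ∈ J, j.2 < N) (f : Job Ω → ℝ) :
    ∑ j ∈ withCopies N J, f j = ∑ j ∈ J, f j + ∑ j ∈ J, f (copy N j) := by
  classical
  rw [withCopies, Finset.sum_union, Finset.sum_map]
  · rfl
  · refine Finset.disjoint_left.2 fun j hj hj' => ?_
    obtain ⟨i, hi, rfl⟩ := Finset.mem_map.1 hj'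
    exact absurd (hN _ hj) (not_lt.2 (le_copy_snd (hN i hi)))

/-- Two schedules of copies of the same jobs, run at speeds `s` and `1`, together decrease the
residual optimum at a rate of at most `s + 1` times the weight of the unfinished jobs. -/
theorem resOpt_joint_le (hz : Pb.IsSchedule z) (ho : Pb.IsSchedule o) (hs : 0 < s)
    (hN : ∀ j ∈ J, j.2 < N) {a b : ℝ} (h : ∀ j ∈ J, I.release j ≤ a) (hab : a ≤ b) :
    Pb.resOpt (withCopies N J) (joint N (remaining I s z a) (remaining I 1 o a)) ≤
      Pb.resOpt (withCopies N J) (joint N (remaining I s z b) (remaining I 1 o b)) +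
        (s + 1) * (Pb.weightedSpent I s z J b - Pb.weightedSpent I s z J a +
          (Pb.weightedSpent I 1 o J b - Pb.weightedSpent I 1 o J a)) := by
  have hs1 : 0 < s + 1 := by linarith
  obtain ⟨y, hy, hl, hr⟩ : ∃ y, Pb.IsSchedule y ∧ (∀ j ∈ J, ∀ t, (s + 1) * y t j = s * z t j) ∧
      ∀ j ∈ J, ∀ t, (s + 1) * y t (copy N j) = 1 * o t j := by
    -- At speed `s + 1` the shares `s / (s + 1)` and `1 / (s + 1)` become the speeds `s` and `1`.
    refine ⟨_, hz.joint (N := N) ho (p := s / (s + 1)) (q := 1 / (s + 1)) (by positivity)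
      (by positivity) (by field_simp), fun j hj t => ?_, fun j hj t => ?_⟩
    · rw [joint_left (hN j hj)]
      field_simp
    · rw [joint_copy (hN j hj)]
      field_simp
  refine (resOpt_le_run hy hs1 hab).trans_eq ?_
  congr 1
  · refine resOpt_congr fun j hj => ?_
    rcases mem_withCopies.1 hj with hj | ⟨i, hi, rfl⟩
    · simp only [hl j hj, joint_left (hN j hj)]
      exact (remaining_advance hz hs.le (h j hj) hab).symm
    · simp only [hr i hi, joint_copy (hN i hi)]
      exact (remaining_advance ho zero_le_one (h i hi) hab).symm
  · rw [sum_withCopies hN]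
    simp only [weightedSpent]
    rw [← Finset.sum_sub_distrib, ← Finset.sum_sub_distrib, mul_add, Finset.mul_sum, Finset.mul_sum]
    congr 1
    · refine Finset.sum_congr rfl fun j hj => ?_
      simp only [hl j hj, joint_left (hN j hj)]
      rw [spent_sub hz hs.le (h j hj) hab]
      ring
    · refine Finset.sum_congr rfl fun j hj => ?_
      simp only [hr j hj, joint_copy (hN j hj), copy_fst]
      rw [spent_sub ho zero_le_one (h j hj) hab]
      ring

/-- Renaming copies of the same kind of job. -/
theorem resOpt_comp_le (e : Equiv.Perm (Job Ω)) (he : ∀ j, (e j).1 = j.1) :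
    Pb.resOpt S (fun j => x (e j)) ≤ Pb.resOpt (S.map e.toEmbedding) x := by
  refine ENNReal.toReal_mono (Pb.residualOptimum_ne_top _ _) (le_iInf₂ fun z hz => ?_)
  have hz' : Pb.IsSchedule (fun t j => z t (e j)) :=
    ⟨measurable_pi_iff.2 fun j => measurable_pi_iff.1 hz.1 (e j),
      fun t => Pb.copies_symm e he _ (hz.2 t)⟩
  refine (residualOptimum_le_completionCost hz').trans_eq ?_
  rw [completionCost, Finset.sum_map]
  exact Finset.sum_congr rfl fun j _ => by simp [he]

open scoped Classical in
theorem HasSupermodularResidualOptimum.resOpt_add_le (h : Pb.HasSupermodularResidualOptimum)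
    (hx : ∀ j, 0 ≤ x j) (U V : Finset (Job Ω)) :
    Pb.resOpt U x + Pb.resOpt V x ≤ Pb.resOpt (U ∪ V) x + Pb.resOpt (U ∩ V) x := by
  have := ENNReal.toReal_mono (ENNReal.add_ne_top.2
    ⟨Pb.residualOptimum_ne_top _ _, Pb.residualOptimum_ne_top _ _⟩) (h x hx U V)
  rwa [ENNReal.toReal_add (Pb.residualOptimum_ne_top _ _) (Pb.residualOptimum_ne_top _ _),
    ENNReal.toReal_add (Pb.residualOptimum_ne_top _ _) (Pb.residualOptimum_ne_top _ _)] at this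

open scoped Classical in
/-- The arrival of a job increases the residual optimum of both copies of the instance at least
twice as much as that of a single one. -/
theorem HasSupermodularResidualOptimum.two_mul_resOpt_insert_le
    (h : Pb.HasSupermodularResidualOptimum) {a : Job Ω} (haJ : a ∉ J) (hu : ∀ j, 0 ≤ u j)
    (hv : ∀ j, 0 ≤ v j) (huv : u a = v a) (hN : ∀ j ∈ insert a J, j.2 < N) :
    2 * (Pb.resOpt (insert a J) u - Pb.resOpt J u) ≤
      Pb.resOpt (withCopies N (insert a J)) (joint N u v) -
        Pb.resOpt (withCopies N J) (joint N u v) := by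
  have hx : ∀ j, 0 ≤ joint N u v j := fun j => by
    unfold joint
    split_ifs
    · exact hu _
    · exact hv _
  have haN := hN a (Finset.mem_insert_self a J)
  have hJN : ∀ j ∈ J, j.2 < N := fun j hj => hN j (Finset.mem_insert_of_mem hj)
  have hcN := le_copy_snd haN
  have hcJ : copy N a ∉ J := fun hc => absurd (hJN _ hc) (not_lt.2 hcN)
  have hca : copy N a ≠ a := fun hc => by rw [hc] at hcN; omega
  have haB : a ∉ withCopies N J := by
    rw [mem_withCopies]
    rintro (hj | ⟨i, hi, rfl⟩)
    · exact haJ hj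
    · exact absurd haN (not_lt.2 (le_copy_snd (hJN i hi)))
  have hcB : copy N a ∉ withCopies N J := by
    rw [mem_withCopies]
    rintro (hj | ⟨i, hi, hia⟩)
    · exact hcJ hj
    · exact haJ ((copy N).injective hia ▸ hi)
  have hJB : J ⊆ withCopies N J := fun j hj => mem_withCopies.2 (Or.inl hj)
  have e1 : Pb.resOpt (insert a J) u = Pb.resOpt (insert a J) (joint N u v) :=
    resOpt_congr fun j hj => (joint_left (hN j hj)).symm
  have e2 : Pb.resOpt J u = Pb.resOpt J (joint N u v) :=
    resOpt_congr fun j hj => (joint_left (hJN j hj)).symm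
  have e3 : withCopies N (insert a J) = insert (copy N a) (insert a (withCopies N J)) := by
    ext j
    simp only [mem_withCopies, Finset.mem_insert]
    constructor
    · rintro ((rfl | hj) | ⟨i, rfl | hi, rfl⟩)
      · exact Or.inr (Or.inl rfl)
      · exact Or.inr (Or.inr (Or.inl hj))
      · exact Or.inl rfl
      · exact Or.inr (Or.inr (Or.inr ⟨i, hi, rfl⟩))
    · rintro (rfl | rfl | hj | ⟨i, hi, rfl⟩)
      · exact Or.inr ⟨a, Or.inl rfl, rfl⟩
      · exact Or.inl (Or.inl rfl)
      · exact Or.inl (Or.inr hj)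
      · exact Or.inr ⟨i, Or.inr hi, rfl⟩
  -- With B the doubled set, adding `a` to B costs at least as much as adding it to `J`, and adding
  -- the copy of `a` after that costs at least as much as adding the copy to `J`.
  have s1 := h.resOpt_add_le hx (withCopies N J) (insert a J)
  have s2 := h.resOpt_add_le hx (insert a (withCopies N J)) (insert (copy N a) J)
  rw [Finset.inter_insert_of_notMem haB, Finset.inter_eq_right.2 hJB, Finset.union_insert,
    Finset.union_eq_left.2 hJB] at s1
  rw [Finset.inter_insert_of_notMem (by simp [hca, hcB]),
    Finset.inter_eq_right.2 (hJB.trans (Finset.subset_insert _ _)), Finset.union_insert,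
    Finset.union_eq_left.2 (hJB.trans (Finset.subset_insert _ _))] at s2
  -- `a` and its copy have the same kind and, by `huv`, the same remaining size, so exchanging them
  -- is harmless.
  have s3 : Pb.resOpt (insert a J) (joint N u v) ≤
      Pb.resOpt (insert (copy N a) J) (joint N u v) := by
    have hfix : ∀ j ∈ J, Equiv.swap a (copy N a) j = j := fun j hj =>
      Equiv.swap_apply_of_ne_of_ne (fun hja => haJ (hja ▸ hj)) (fun hja => hcJ (hja ▸ hj))
    have hkind : ∀ j, (Equiv.swap a (copy N a) j).1 = j.1 := by
      intro j
      rw [Equiv.swap_apply_def]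
      split_ifs with h1 h2
      · rw [h1, copy_fst]
      · rw [h2, copy_fst]
      · rfl
    have := resOpt_comp_le (Pb := Pb) (S := insert a J) (x := joint N u v) _ hkind
    have hmap : (insert a J).map (Equiv.swap a (copy N a)).toEmbedding = insert (copy N a) J := by
      rw [Finset.map_insert]
      congr 1
      · simp
      · ext j
        rw [Finset.mem_map]
        constructor
        · rintro ⟨i, hi, rfl⟩
          simpa [hfix i hi] using hi
        · exact fun hj => ⟨j, hj, by simpa using hfix j hj⟩
    rw [hmap] at this
    refine le_trans (le_of_eq (resOpt_congr fun j hj => ?_)) this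
    rcases Finset.mem_insert.1 hj with rfl | hj
    · rw [Equiv.swap_apply_left, joint_left haN, joint_copy haN, huv]
    · rw [hfix j hj]
  rw [e1, e2, e3]
  linarith

/-! ### The potential argument -/

/-- Induction over the jobs in order of release: the hypothesis is used at the release of the last
job, followed by the jump there and the drift up to `T`. The non-strict inequalities on release
times let simultaneous releases be handled one at a time. -/
theorem IsGradientDescent.potential_le (hsup : Pb.HasSupermodularResidualOptimum) {ε : ℝ}
    (hε : 0 < ε) (hgd : Pb.IsGradientDescent I (1 + ε) z) (ho : Pb.IsSchedule o)
    (hN : ∀ j ∈ I.jobs, j.2 < N) (hJ : J ⊆ I.jobs) {T : ℝ} (hT : 0 ≤ T)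
    (hrel : ∀ j ∈ J, I.release j ≤ T) (hrel' : ∀ j ∈ I.jobs, j ∉ J → T ≤ I.release j) :
    Pb.resOpt J (remaining I (1 + ε) z T) -
        Pb.resOpt (withCopies N J)
          (joint N (remaining I (1 + ε) z T) (remaining I 1 o T)) / 2 +
        ε / 2 * Pb.weightedSpent I (1 + ε) z J T ≤
      (1 + ε / 2) * Pb.weightedSpent I 1 o J T := by
  classical
  have hs : 0 < 1 + ε := by linarith
  induction J using Finset.induction_on_max_value I.release generalizing T with
  | empty =>
    have := resOpt_nonneg (Pb := Pb) (S := withCopies N ∅)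
      (x := joint N (remaining I (1 + ε) z T) (remaining I 1 o T))
    simp only [resOpt_empty, weightedSpent, Finset.sum_empty]
    linarith
  | insert a J haJ hmax ih =>
    have haI : a ∈ I.jobs := hJ (Finset.mem_insert_self a J)
    have hJI : J ⊆ I.jobs := (Finset.subset_insert a J).trans hJ
    have haT := hrel a (Finset.mem_insert_self a J)
    have hrel0 : ∀ j ∈ insert a J, I.release j ≤ I.release a := fun j hj => by
      rcases Finset.mem_insert.1 hj with rfl | hj
      · exact le_rfl
      · exact hmax j hj
    have hN' : ∀ j ∈ insert a J, j.2 < N := fun j hj => hN j (hJ hj)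
    have h0 := ih hJI (I.release_nonneg a haI) hmax fun j hj hjJ => by
      by_cases hja : j = a
      · rw [hja]
      · exact haT.trans (hrel' j hj (by simp [hja, hjJ]))
    -- At its release `a` has its full size in both schedules.
    have h1 := hsup.two_mul_resOpt_insert_le (N := N) haJ
      (remaining_nonneg I (1 + ε) z (I.release a)) (remaining_nonneg I 1 o (I.release a))
      (by simp [remaining]) hN'
    have hins : ∀ (s : ℝ) (z : ℝ → Job Ω → ℝ), Pb.weightedSpent I s z (insert a J) (I.release a) =
        Pb.weightedSpent I s z J (I.release a) := fun s z => by
      simp [weightedSpent, Finset.sum_insert haJ, spent_release]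
    have h2 := hgd.resOpt_add_le hs (I.release_nonneg a haI) haT hJ hrel0 hrel'
    have h3 := resOpt_joint_le hgd.1 ho hs hN' hrel0 haT
    rw [← hins, ← hins] at h0
    -- The coefficients come from h0 + h1/2 + h2 + h3/2, with s − (s + 1)/2 = ε/2 and (s + 1)/2 = 1
    -- + ε/2 for s = 1 + ε.
    linarith

theorem tendsto_min_completionDelay (ρ : ℝ → ℝ) (r x : ℝ) :
    Tendsto (fun T => min (completionDelay ρ r x) (ENNReal.ofReal (T - r))) atTop
      (𝓝 (completionDelay ρ r x)) := by
  have h : Tendsto (fun T : ℝ => ENNReal.ofReal (T - r)) atTop (𝓝 ⊤) :=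
    ENNReal.tendsto_ofReal_atTop.comp (tendsto_atTop_add_const_right _ (-r) tendsto_id)
  simpa using tendsto_const_nhds.min h

theorem ofReal_weightedSpent (T : ℝ) :
    ENNReal.ofReal (Pb.weightedSpent I s z S T) = ∑ j ∈ S, (Pb.weight j.1 : ℝ≥0∞) *
      min (completionDelay (fun t => s * z t j) (I.release j) (I.size j))
        (ENNReal.ofReal (T - I.release j)) := by
  unfold weightedSpent
  rw [ENNReal.ofReal_sum_of_nonneg fun j _ => mul_nonneg (Pb.weight j.1).2 spent_nonneg]
  refine Finset.sum_congr rfl fun j _ => ?_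
  rw [ENNReal.ofReal_mul (NNReal.coe_nonneg _), ENNReal.ofReal_coe_nnreal, spent, ENNReal.ofReal_toReal]
  exact ne_top_of_le_ne_top ENNReal.ofReal_ne_top (min_le_right _ _)

theorem ofReal_weightedSpent_le (T : ℝ) :
    ENNReal.ofReal (Pb.weightedSpent I s z I.jobs T) ≤ Pb.weightedFlowTime I s z := by
  rw [ofReal_weightedSpent]
  exact Finset.sum_le_sum fun j _ => mul_le_mul_right (min_le_left _ _) _

/-- Weight 0 must be allowed for: since 0 · ∞ = 0, finite cost does not force such jobs to complete.
-/
theorem eventually_finished (ho : Pb.IsSchedule o) (hs : 0 ≤ s)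
    (hcost : Pb.weightedFlowTime I s o ≠ ⊤) :
    ∀ᶠ T in atTop, ∀ j ∈ I.jobs, remaining I s o T j = 0 ∨ Pb.weight j.1 = 0 := by
  refine (Filter.eventually_all_finset I.jobs).2 fun j hj => ?_
  by_cases hw : Pb.weight j.1 = 0
  · exact Eventually.of_forall fun _ => Or.inr hw
  have hd : completionDelay (fun t => s * o t j) (I.release j) (I.size j) < ⊤ := by
    rw [lt_top_iff_ne_top]
    intro htop
    refine ENNReal.sum_ne_top.1 hcost j hj ?_
    rw [htop, ENNReal.mul_top (by simpa using hw)]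
  have h : Tendsto (fun T : ℝ => ENNReal.ofReal (T - I.release j)) atTop (𝓝 ⊤) :=
    ENNReal.tendsto_ofReal_atTop.comp
      (tendsto_atTop_add_const_right _ (-I.release j) tendsto_id)
  filter_upwards [h.eventually_const_lt hd, eventually_ge_atTop (I.release j)] with T hT hr
  left
  have := ((ho.isRate j).const_mul hs).le_integral_of_completionDelay_lt hT
  rw [add_sub_cancel] at this
  rw [remaining_of_release_le hr]
  exact max_eq_right (by linarith)

theorem IsGradientDescent.weightedFlowTime_le (hsup : Pb.HasSupermodularResidualOptimum) {ε : ℝ}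
    (hε : 0 < ε) (hgd : Pb.IsGradientDescent I (1 + ε) z) (ho : Pb.IsSchedule o) :
    Pb.weightedFlowTime I (1 + ε) z ≤
      ENNReal.ofReal (3 * max 1 (1 / ε)) * Pb.weightedFlowTime I 1 o := by
  classical
  have hM1 : 1 ≤ max 1 (1 / ε) := le_max_left _ _
  have hM2 : 1 / ε ≤ max 1 (1 / ε) := le_max_right _ _
  by_cases hcost : Pb.weightedFlowTime I 1 o = ⊤
  · rw [hcost, ENNReal.mul_top (by simp)]
    exact le_top
  obtain ⟨N, hN⟩ : ∃ N, ∀ j ∈ I.jobs, j.2 < N :=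
    ⟨I.jobs.sup Prod.snd + 1, fun j hj => Nat.lt_succ_of_le (Finset.le_sup (f := Prod.snd) hj)⟩
  have hlim : Tendsto (fun T => ENNReal.ofReal (Pb.weightedSpent I (1 + ε) z I.jobs T)) atTop
      (𝓝 (Pb.weightedFlowTime I (1 + ε) z)) := by
    simp only [ofReal_weightedSpent]
    exact tendsto_finsetSum _ fun j _ => ENNReal.Tendsto.const_mul
      (tendsto_min_completionDelay _ _ _) (Or.inr ENNReal.coe_ne_top)
  refine le_of_tendsto hlim ?_
  filter_upwards [eventually_finished ho zero_le_one hcost, eventually_ge_atTop 0,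
    (Filter.eventually_all_finset I.jobs).2 fun j _ => eventually_ge_atTop (I.release j)]
    with T hfin hT hrel
  have hpot := hgd.potential_le hsup hε ho hN subset_rfl hT hrel fun j hj hj' => absurd hj hj'
  -- Copies that are finished or weightless drop out, so the potential at `T` is half the residual
  -- optimum of the algorithm, hence nonnegative.
  have hjoint : Pb.resOpt (withCopies N I.jobs)
      (joint N (remaining I (1 + ε) z T) (remaining I 1 o T)) =
      Pb.resOpt I.jobs (remaining I (1 + ε) z T) := by
    have : Pb.resOpt I.jobs (remaining I (1 + ε) z T) = Pb.resOpt I.jobs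
        (joint N (remaining I (1 + ε) z T) (remaining I 1 o T)) :=
      resOpt_congr fun j hj => (joint_left (hN j hj)).symm
    rw [this]
    refine congrArg ENNReal.toReal (residualOptimum_of_subset
      (fun j hj => mem_withCopies.2 (Or.inl hj)) fun j hj hj' => ?_)
    rcases mem_withCopies.1 hj with hj | ⟨i, hi, rfl⟩
    · exact absurd hj hj'
    · rw [joint_copy (hN i hi), copy_fst]
      exact (hfin i hi).imp_left le_of_eq
  rw [hjoint] at hpot
  have hg := resOpt_nonneg (Pb := Pb) (S := I.jobs) (x := remaining I (1 + ε) z T)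
  have hO : 0 ≤ Pb.weightedSpent I 1 o I.jobs T :=
    Finset.sum_nonneg fun j _ => mul_nonneg (Pb.weight j.1).2 spent_nonneg
  -- The factor 3 comes from 2/ε + 1 ≤ 3 max{1, 1/ε}.
  have hreal : Pb.weightedSpent I (1 + ε) z I.jobs T ≤
      3 * max 1 (1 / ε) * Pb.weightedSpent I 1 o I.jobs T := by
    have h1 : ε / 2 * Pb.weightedSpent I (1 + ε) z I.jobs T ≤
        (1 + ε / 2) * Pb.weightedSpent I 1 o I.jobs T := by linarith
    have h2 : Pb.weightedSpent I (1 + ε) z I.jobs T ≤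
        (2 * (1 / ε) + 1) * Pb.weightedSpent I 1 o I.jobs T := by
      have h3 := mul_le_mul_of_nonneg_left h1 (show 0 ≤ 2 * (1 / ε) by positivity)
      have h4 : ∀ w : ℝ, 2 * (1 / ε) * (ε / 2 * w) = w := fun w => by field_simp
      have h5 : ∀ w : ℝ, 2 * (1 / ε) * ((1 + ε / 2) * w) = (2 * (1 / ε) + 1) * w := fun w => by
        field_simp
      rwa [h4, h5] at h3
    refine h2.trans (mul_le_mul_of_nonneg_right ?_ hO)
    linarith
  calc _ ≤ ENNReal.ofReal (3 * max 1 (1 / ε) * Pb.weightedSpent I 1 o I.jobs T) :=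
        ENNReal.ofReal_le_ofReal hreal
    _ = ENNReal.ofReal (3 * max 1 (1 / ε)) * ENNReal.ofReal (Pb.weightedSpent I 1 o I.jobs T) :=
        ENNReal.ofReal_mul (by linarith)
    _ ≤ _ := by
        gcongr
        exact ofReal_weightedSpent_le T

end SchedulingProblem

end

theorem mainTheorem1 :
    ∃ C : ℝ, 0 < C ∧
      ∀ (Ω : Type u) (Pb : SchedulingProblem Ω), Pb.HasSupermodularResidualOptimum →
        ∀ ε : ℝ, 0 < ε →
          (∃ A : SchedulingInstance Ω → ℝ → Job Ω → ℝ,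
            IsOnline A ∧ ∀ I, Pb.IsGradientDescent I (1 + ε) (A I)) ∧
          ∀ (I : SchedulingInstance Ω) (z : ℝ → Job Ω → ℝ), Pb.IsGradientDescent I (1 + ε) z →
            Pb.weightedFlowTime I (1 + ε) z ≤
              ENNReal.ofReal (C * max 1 (1 / ε)) * Pb.optimalFlowTime I := by
  refine ⟨3, by norm_num, fun Ω Pb hsup ε hε => ⟨⟨Pb.onlineSchedule (1 + ε),
    SchedulingProblem.isOnline_onlineSchedule Pb _, fun I =>
      SchedulingProblem.isGradientDescent_onlineSchedule Pb (by linarith) I⟩, fun I z hz => ?_⟩⟩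
  have hC : 0 < 3 * max 1 (1 / ε) := by positivity
  rw [SchedulingProblem.optimalFlowTime,
    ENNReal.mul_iInf_of_ne (by simp) ENNReal.ofReal_ne_top]
  refine le_iInf fun o => ?_
  rw [ENNReal.mul_iInf' (fun h => absurd h ENNReal.ofReal_ne_top)
    (fun h => absurd h (by simp))]
  exact le_iInf fun ho => hz.weightedFlowTime_le hsup hε ho
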